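/- Consider online makespan minimization over time on $m=3$ identical machines: finitely many jobs $j$, each with a release time $r_j\ge 0$ (at which it becomes known) and a processing time $p_j>0$, have to be processed non-preemptively, each job $j$ starting at a time $s_j\ge r_j$ and completing at $C_j=s_j+p_j$; the objective is the makespan $\max_j C_j$. At time $t$ a job is pending if it is released but not yet started. Generalized SLEEPY without dynamic locking ($\lambda=1$), with locking parameter $\alpha$, works as follows: at any moment, if some machine is idle (neither processing a job nor locked) and some job is pending, it selects an arbitrary idle machine, starts on it a longest pending job $j$ (ties broken arbitrarily), and locks all machines until time $s_j+\alpha p_j$, i.e. no further job may start before that time. With $\alpha=0.07066$ and $\gamma=0.4817$, this algorithm is $(1+\gamma)$-competitive for $m=3$, and hence $1.482$-competitive: on every instance it schedules all jobs, and every schedule that it can produce has makespan at most $1.4817$ times the makespan of an optimal offline schedule. -/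

import Mathlib

/-- A finite job set: every job has a release time `r j ≥ 0` and a processing time `p j > 0`. -/
structure JobSet (J : Type*) where
  /-- release times -/
  r : J → ℝ
  /-- processing times -/
  p : J → ℝ
  r_nonneg : ∀ j, 0 ≤ r j
  p_pos : ∀ j, 0 < p j

/-- A non-preemptive assignment of the jobs to `m` identical machines and to start times. -/
structure Schedule (m : ℕ) (J : Type*) where
  /-- start times -/
  s : J → ℝ
  /-- the machine that processes the job -/
  machine : J → Fin m

noncomputable section

namespace JobSet

variable {m : ℕ} {J : Type*}

/-- Completion time of job `j`. -/
def completion (I : JobSet J) (S : Schedule m J) (j : J) : ℝ := S.s j + I.p j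

/-- The makespan, i.e. the largest completion time (`0` for the empty job set). -/
def makespan (I : JobSet J) (S : Schedule m J) : ℝ := ⨆ j, I.completion S j

/-- Feasibility: no job starts before its release, and two jobs on one machine do not overlap. -/
def Feasible (I : JobSet J) (S : Schedule m J) : Prop :=
  (∀ j, I.r j ≤ S.s j) ∧
    ∀ i j, i ≠ j → S.machine i = S.machine j →
      I.completion S i ≤ S.s j ∨ I.completion S j ≤ S.s i

/-- The optimal offline makespan on `m` machines. -/
def opt (m : ℕ) (I : JobSet J) : ℝ :=
  sInf {x | ∃ S : Schedule m J, I.Feasible S ∧ I.makespan S = x}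

/-- Job `j` is pending at time `t`: it is released and has not been started. -/
def Pending (I : JobSet J) (S : Schedule m J) (t : ℝ) (j : J) : Prop :=
  I.r j ≤ t ∧ t < S.s j

/-- Machine `M` is busy at time `t`: it is processing some job. -/
def Busy (I : JobSet J) (S : Schedule m J) (t : ℝ) (M : Fin m) : Prop :=
  ∃ j, S.machine j = M ∧ S.s j ≤ t ∧ t < I.completion S j

/-- The locking parameter `α_j = lam ^ (- s_j / p_j) * α` of job `j`. -/
def lockParam (lam α : ℝ) (I : JobSet J) (S : Schedule m J) (j : J) : ℝ :=
  lam ^ (-(S.s j / I.p j)) * α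

/-- Job `j`, once started, keeps all machines locked from `s_j` until `s_j + α_j * p_j`. -/
def LockedBy (lam α : ℝ) (I : JobSet J) (S : Schedule m J) (t : ℝ) (j : J) : Prop :=
  S.s j ≤ t ∧ t < S.s j + I.lockParam lam α S j * I.p j

/-- Machine `M` is idle at time `t`: it is neither busy nor locked. -/
def Idle (lam α : ℝ) (I : JobSet J) (S : Schedule m J) (t : ℝ) (M : Fin m) : Prop :=
  ¬ I.Busy S t M ∧ ¬ ∃ j, I.LockedBy lam α S t j

/-- `S` is a schedule that Generalized SLEEPY with locking parameters `lam` and `α` can produce,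
the choice among idle machines and among pending jobs of equal length being arbitrary. -/
structure IsGeneralizedSleepy (lam α : ℝ) (I : JobSet J) (S : Schedule m J) : Prop where
  feasible : I.Feasible S
  /-- No job starts while the machines are locked by another job. -/
  not_locked : ∀ i j, i ≠ j → ¬ I.LockedBy lam α S (S.s j) i
  /-- The job that is started is a longest one among the pending jobs. -/
  longest : ∀ i j, I.Pending S (S.s j) i → I.p i ≤ I.p j
  /-- As long as some machine is idle, pending jobs are started at once: whenever a machine is
  (still) idle at time `t`, no job is (still) pending at `t`. -/
  greedy : ∀ t M, I.Idle lam α S t M → ∀ j, ¬ I.Pending S t j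

end JobSet

end

/-! Fix an offline schedule ending by `T` and suppose that SLEEPY completes a job `ℓ` after `1.4817
T`. Let `c` be a critical time (`exists_isCriticalTime`): no machine is idle from `c` until `ℓ`
starts, and at most two jobs run across `c`. Online, a job of length `p` occupies the machines for
at most `(1 + 2α) p`, as its lock blocks the two other machines; offline, the work after `c` is at
most `3 (T - c)`. Comparing the two gives `T - c < 2 p ℓ` (`sub_critical_lt`) and then `p ℓ > 0.1348
T` (`lt_of_completion_gt`).

Look back from the start of `ℓ` (`exists_chain`): a chain `Q` of locking jobs, and before it a time
`τ` up to which three jobs run. Those of all these jobs that start after the release of `ℓ` are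
"big": at least as long as `ℓ` by the longest-first rule, and released from `c` on. Since `T - c < 2
p ℓ`, no two of them, nor `ℓ` and one of them, share an offline machine, so there are few of them
and only six cases. The other jobs at `τ` are "old": they start before the release of `ℓ` but run
almost until `ℓ` starts, so they are longer than a `δ` equal to `0.4817 T` minus the locks of `Q`.
An old job `Y` whose offline machine has a big job must precede it there
(`release_add_le_of_hasBig`), so it is released early and waits online for longer than `δ`.

A long job cannot wait that long: looking back from the start of `Y` in the same way
(`exists_heavy`) reveals three more fairly long jobs, which do not fit on the offline machines
together with `Y`, the chain and the big jobs. The lemmas `three_big_*` and `two_big_*` carry out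
this packing argument. If `ℓ` is the only big job, counting work suffices (`false_of_none_new`). The
cases meet in `completion_le`. -/

open MeasureTheory

/-! ### Overlaps of intervals. -/

/-- Length of the intersection of the intervals `[x, y)` and `[u, v)`. -/
noncomputable def overlap (x y u v : ℝ) : ℝ := max 0 (min v y - max u x)

lemma overlap_nonneg (x y u v : ℝ) : 0 ≤ overlap x y u v := le_max_left _ _

lemma overlap_le {x y u v b : ℝ} (hb : 0 ≤ b) (h : min v y - max u x ≤ b) :
    overlap x y u v ≤ b := max_le hb h

lemma overlap_le_length {x y u v : ℝ} (h : u ≤ v) : overlap x y u v ≤ v - u :=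
  overlap_le (by linarith) (by linarith [min_le_left v y, le_max_left u x])

lemma overlap_eq_length {x y u v : ℝ} (h : u ≤ v) (hx : x ≤ u) (hy : v ≤ y) :
    overlap x y u v = v - u := by
  rw [overlap, min_eq_left hy, max_eq_left hx, max_eq_right (by linarith)]

lemma overlap_eq_zero_of_le {x y u v : ℝ} (h : v ≤ x) : overlap x y u v = 0 :=
  max_eq_left (by linarith [min_le_left v y, le_max_right u x])

lemma overlap_eq_zero_of_ge {x y u v : ℝ} (h : y ≤ u) : overlap x y u v = 0 :=
  max_eq_left (by linarith [min_le_right v y, le_max_left u x])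

lemma le_overlap (x y u v : ℝ) : min v y - max u x ≤ overlap x y u v := le_max_right _ _

/-- Two disjoint windows see at most the whole interval. -/
lemma overlap_add_overlap_le {x y x' y' u v : ℝ} (h : u ≤ v) (hy : y ≤ x') :
    overlap x y u v + overlap x' y' u v ≤ v - u := by
  have h1 := min_le_left v y
  have h2 := min_le_right v y
  have h3 := min_le_left v y'
  have h5 := le_max_left u x
  have h6 := le_max_left u x'
  have h7 := le_max_right u x'
  unfold overlap
  rcases max_cases (0 : ℝ) (min v y - max u x) with ⟨h8, -⟩ | ⟨h8, -⟩ <;>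
  rcases max_cases (0 : ℝ) (min v y' - max u x') with ⟨h9, -⟩ | ⟨h9, -⟩ <;>
  rw [h8, h9] <;> linarith

lemma volume_Ico_inter (x y u v : ℝ) :
    volume (Set.Ico u v ∩ Set.Ico x y) = ENNReal.ofReal (overlap x y u v) := by
  rw [Set.Ico_inter_Ico, Real.volume_Ico, overlap]
  rcases le_total (min v y - max u x) 0 with h | h
  · rw [max_eq_left h, ENNReal.ofReal_of_nonpos h, ENNReal.ofReal_zero]
  · rw [max_eq_right h]

lemma length_le_sum_overlap {ι : Type*} (A : Finset ι) (u v : ι → ℝ) {x y : ℝ}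
    (h : ∀ t, x ≤ t → t < y → ∃ j ∈ A, u j ≤ t ∧ t < v j) :
    y - x ≤ ∑ j ∈ A, overlap x y (u j) (v j) := by
  have hsub : Set.Ico x y ⊆ ⋃ j ∈ A, Set.Ico (u j) (v j) ∩ Set.Ico x y := by
    intro t ht
    obtain ⟨j, hj, h1, h2⟩ := h t ht.1 ht.2
    simp only [Set.mem_iUnion]
    exact ⟨j, hj, ⟨h1, h2⟩, ht⟩
  have h1 := (measure_mono (μ := volume) hsub).trans (measure_biUnion_finset_le A _)
  simp only [volume_Ico_inter, Real.volume_Ico] at h1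
  rw [← ENNReal.ofReal_sum_of_nonneg (fun j _ => overlap_nonneg _ _ _ _)] at h1
  exact (ENNReal.ofReal_le_ofReal_iff
    (Finset.sum_nonneg fun j _ => overlap_nonneg _ _ _ _)).1 h1

lemma sum_overlap_le_length {ι : Type*} (A : Finset ι) (u v : ι → ℝ) {x y : ℝ} (hxy : x ≤ y)
    (h : ∀ i ∈ A, ∀ j ∈ A, i ≠ j → v i ≤ u j ∨ v j ≤ u i) :
    ∑ j ∈ A, overlap x y (u j) (v j) ≤ y - x := by
  have hd : (A : Set ι).PairwiseDisjoint fun j => Set.Ico (u j) (v j) ∩ Set.Ico x y := by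
    intro i hi j hj hij
    refine Set.disjoint_left.2 fun t ht ht' => ?_
    rcases h i hi j hj hij with h | h
    · linarith [ht.1.2, ht'.1.1]
    · linarith [ht'.1.2, ht.1.1]
  have h1 := measure_biUnion_finset (μ := volume) hd
    (fun j _ => measurableSet_Ico.inter measurableSet_Ico)
  have hsub : (⋃ j ∈ A, Set.Ico (u j) (v j) ∩ Set.Ico x y) ⊆ Set.Ico x y := by
    intro t ht
    simp only [Set.mem_iUnion] at ht
    obtain ⟨j, -, ht⟩ := ht
    exact ht.2
  have h2 := measure_mono (μ := volume) hsub
  rw [h1] at h2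
  simp only [volume_Ico_inter, Real.volume_Ico] at h2
  rw [← ENNReal.ofReal_sum_of_nonneg (fun j _ => overlap_nonneg _ _ _ _)] at h2
  exact (ENNReal.ofReal_le_ofReal_iff (by linarith)).1 h2

/-! ### The two schedules, and bounds on their loads. -/

/-- No machine is idle at time `t`: each machine is processing a job, or all are locked. -/
def NonIdle {J : Type*} (p s : J → ℝ) (μ : J → Fin 3) (t : ℝ) : Prop :=
  ∀ M, (∃ j, μ j = M ∧ s j ≤ t ∧ t < s j + p j) ∨
    ∃ j, s j ≤ t ∧ t < s j + 3533 / 50000 * p j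

/-- A SLEEPY schedule with start times `s` and machines `μ`, together with an offline schedule
of the same jobs with start times `q` and machines `ν` that ends by time `T`. -/
structure Comparison {J : Type*} (r p s q : J → ℝ) (μ ν : J → Fin 3) (T : ℝ) : Prop where
  r_nonneg : ∀ j, 0 ≤ r j
  p_pos : ∀ j, 0 < p j
  release_le : ∀ j, r j ≤ s j
  disj : ∀ i j, i ≠ j → μ i = μ j → s i + p i ≤ s j ∨ s j + p j ≤ s i
  lock : ∀ i j, s i < s j → s i + 3533 / 50000 * p i ≤ s j
  start_inj : ∀ i j, s i = s j → i = j
  longest : ∀ i j, r i ≤ s j → s j < s i → p i ≤ p j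
  nonIdle : ∀ i t, r i ≤ t → t < s i → NonIdle p s μ t
  release_le_off : ∀ j, r j ≤ q j
  disj_off : ∀ i j, i ≠ j → ν i = ν j → q i + p i ≤ q j ∨ q j + p j ≤ q i
  deadline : ∀ j, q j + p j ≤ T

/-- A time `c` from which on no machine is idle until `ℓ` starts, such that the jobs started from
`c` on are released from `c` on, no lock extends over `c`, and at most two jobs run across `c`. -/
structure IsCriticalTime {J : Type*} (r p s : J → ℝ) (μ : J → Fin 3) (ℓ : J) (c : ℝ) : Prop where
  nonneg : 0 ≤ c
  le_release : c ≤ r ℓ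
  release : ∀ j, c ≤ s j → c ≤ r j
  lock : ∀ j, s j < c → s j + 3533 / 50000 * p j ≤ c
  carry : {j | s j < c ∧ c < s j + p j}.ncard ≤ 2
  nonIdle : ∀ t, c ≤ t → t < s ℓ → NonIdle p s μ t

namespace Comparison

variable {J : Type*} {r p s q : J → ℝ} {μ ν : J → Fin 3} {T : ℝ}

lemma release_add_le (h : Comparison r p s q μ ν T) (j : J) : r j + p j ≤ T := by
  linarith [h.release_le_off j, h.deadline j]

lemma p_le (h : Comparison r p s q μ ν T) (j : J) : p j ≤ T := by
  linarith [h.release_add_le j, h.r_nonneg j]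

lemma start_nonneg (h : Comparison r p s q μ ν T) (j : J) : 0 ≤ s j :=
  (h.r_nonneg j).trans (h.release_le j)

section Load

variable [Fintype J]

/-- At every moment each machine is processing or locked. A job counts in full on its own machine,
where processing covers its lock, and only with its lock on the two others. -/
lemma load (h : Comparison r p s q μ ν T) {x y : ℝ}
    (hn : ∀ t, x ≤ t → t < y → NonIdle p s μ t) :
    3 * (y - x) ≤ ∑ j, (overlap x y (s j) (s j + p j) +
      2 * overlap x y (s j) (s j + 3533 / 50000 * p j)) := by
  have h1 : ∀ M : Fin 3, y - x ≤ ∑ j, overlap x y (s j)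
      (if μ j = M then s j + p j else s j + 3533 / 50000 * p j) := by
    intro M
    refine length_le_sum_overlap _ _ _ fun t ht ht' => ?_
    rcases hn t ht ht' M with ⟨j, hj, h2, h3⟩ | ⟨j, h2, h3⟩
    · exact ⟨j, Finset.mem_univ _, h2, by rw [if_pos hj]; exact h3⟩
    · refine ⟨j, Finset.mem_univ _, h2, ?_⟩
      have := h.p_pos j
      split_ifs <;> linarith
  have h2 : ∑ j, (overlap x y (s j) (s j + p j) +
      2 * overlap x y (s j) (s j + 3533 / 50000 * p j)) = ∑ M : Fin 3, ∑ j, overlap x y (s j)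
      (if μ j = M then s j + p j else s j + 3533 / 50000 * p j) := by
    rw [Finset.sum_comm]
    refine Finset.sum_congr rfl fun j _ => ?_
    rw [Fin.sum_univ_three]
    generalize μ j = M
    fin_cases M <;> simp <;> ring
  rw [h2, Fin.sum_univ_three]
  linarith [h1 0, h1 1, h1 2]

lemma offline_load (h : Comparison r p s q μ ν T) {x : ℝ} (hx : x ≤ T) :
    ∑ j, overlap x T (q j) (q j + p j) ≤ 3 * (T - x) := by
  classical
  have h1 : ∀ M : Fin 3, ∑ j ∈ Finset.univ.filter (fun j => ν j = M),
      overlap x T (q j) (q j + p j) ≤ T - x := by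
    intro M
    refine sum_overlap_le_length _ _ _ hx fun i hi j hj hij => h.disj_off i j hij ?_
    rw [(Finset.mem_filter.1 hi).2, (Finset.mem_filter.1 hj).2]
  rw [← Finset.sum_fiberwise (g := ν), Fin.sum_univ_three]
  linarith [h1 0, h1 1, h1 2]

lemma sum_p_le (h : Comparison r p s q μ ν T) (hT : 0 ≤ T) : ∑ j, p j ≤ 3 * T := by
  have h1 := h.offline_load hT
  have h2 : ∀ j, overlap 0 T (q j) (q j + p j) = p j := fun j => by
    rw [overlap_eq_length (by linarith [h.p_pos j])
      (by linarith [h.r_nonneg j, h.release_le_off j]) (h.deadline j)]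
    ring
  simp only [h2] at h1
  linarith

end Load

lemma machine_load (h : Comparison r p s q μ ν T) (A : Finset J) (M : Fin 3)
    (hA : ∀ j ∈ A, ν j = M) {x : ℝ} (hx : ∀ j ∈ A, x ≤ r j) (hxT : x ≤ T) :
    x + ∑ j ∈ A, p j ≤ T := by
  have h1 := sum_overlap_le_length A q (fun j => q j + p j) hxT fun i hi j hj hij =>
    h.disj_off i j hij (by rw [hA i hi, hA j hj])
  have h2 : ∀ j ∈ A, overlap x T (q j) (q j + p j) = p j := fun j hj => by
    rw [overlap_eq_length (by linarith [h.p_pos j])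
      (by linarith [hx j hj, h.release_le_off j]) (h.deadline j)]
    ring
  rw [Finset.sum_congr rfl h2] at h1
  linarith

lemma pair_load (h : Comparison r p s q μ ν T) {i j : J} (hij : i ≠ j) (hν : ν i = ν j)
    {x : ℝ} (hi : x ≤ r i) (hj : x ≤ r j) : x + p i + p j ≤ T := by
  rcases h.disj_off i j hij hν with h1 | h1
  · linarith [h.release_le_off i, h.deadline j]
  · linarith [h.release_le_off j, h.deadline i]

lemma pair_le (h : Comparison r p s q μ ν T) {i j : J} (hij : i ≠ j) (hν : ν i = ν j) :
    p i + p j ≤ T := by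
  linarith [h.pair_load hij hν (h.r_nonneg i) (h.r_nonneg j)]

lemma triple_le (h : Comparison r p s q μ ν T) {i j k : J} (hij : i ≠ j) (hik : i ≠ k)
    (hjk : j ≠ k) (hν : ν i = ν j) (hν' : ν i = ν k) : p i + p j + p k ≤ T := by
  classical
  have h1 := h.machine_load {i, j, k} (ν i) (by simp [← hν, ← hν']) (x := 0)
    (fun j _ => h.r_nonneg j) (by linarith [h.p_pos i, h.p_le i])
  rw [Finset.sum_insert (by simp [hij, hik]), Finset.sum_pair hjk] at h1
  linarith

/-! ### Chains of locks and critical times. -/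

/-- Just before time `x`, while job `Y` waits, the machines are locked by a chain `Q` of jobs;
before this chain all three machines are processing jobs. -/
lemma exists_chain_aux [Fintype J] (h : Comparison r p s q μ ν T) (Y : J) (n : ℕ) :
    ∀ x : ℝ, {j | s j < x}.ncard = n → r Y < x → x ≤ s Y →
    ∃ (τ : ℝ) (Q : Finset J), (∀ j ∈ Q, τ ≤ s j ∧ s j < x) ∧
      x ≤ τ + 3533 / 50000 * ∑ j ∈ Q, p j ∧ τ ≤ x ∧
      (τ ≤ r Y ∨ (r Y < τ ∧ ∃ z : Fin 3 → J, Function.Injective z ∧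
        ∀ M, s (z M) < τ ∧ τ ≤ s (z M) + p (z M))) := by
  classical
  induction n using Nat.strong_induction_on with
  | _ n ih =>
  intro x hn hrx hxs
  by_cases hl : ∃ j, s j < x ∧ x ≤ s j + 3533 / 50000 * p j
  · obtain ⟨j, hj1, hj2⟩ := hl
    rcases le_or_gt (s j) (r Y) with hj3 | hj3
    · exact ⟨s j, {j}, by simpa using hj1, by simpa using hj2, hj1.le, Or.inl hj3⟩
    · have hlt : {i | s i < s j}.ncard < n := by
        rw [← hn]
        refine Set.ncard_lt_ncard ⟨fun i hi => lt_trans hi hj1, fun hh => ?_⟩ (Set.toFinite _)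
        exact lt_irrefl (s j) (hh hj1)
      obtain ⟨τ, Q, h1, h2, h3, h4⟩ := ih _ hlt (s j) rfl hj3 (hj1.le.trans hxs)
      have hjQ : j ∉ Q := fun hh => lt_irrefl _ (h1 j hh).2
      refine ⟨τ, insert j Q, ?_, ?_, h3.trans hj1.le, h4⟩
      · intro i hi
        rcases Finset.mem_insert.1 hi with rfl | hi
        · exact ⟨h3, hj1⟩
        · exact ⟨(h1 i hi).1, (h1 i hi).2.trans hj1⟩
      · rw [Finset.sum_insert hjQ]
        linarith
  · push Not at hl
    let E : Finset ℝ := (insert (r Y) (Finset.univ.image s ∪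
      Finset.univ.image (fun j => s j + p j) ∪
      Finset.univ.image (fun j => s j + 3533 / 50000 * p j))).filter (· < x)
    have hrE : r Y ∈ E := by simp [E, hrx]
    obtain ⟨t, htE, htmax⟩ := E.exists_max_image id ⟨_, hrE⟩
    have htx : t < x := (Finset.mem_filter.1 htE).2
    have hrt : r Y ≤ t := htmax _ hrE
    have hni := h.nonIdle Y t hrt (htx.trans_le hxs)
    have hz : ∀ M : Fin 3, ∃ j, μ j = M ∧ s j < x ∧ x ≤ s j + p j := by
      intro M
      rcases hni M with ⟨j, hj, h2, h3⟩ | ⟨j, h2, h3⟩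
      · refine ⟨j, hj, h2.trans_lt htx, ?_⟩
        by_contra hc
        have : s j + p j ∈ E := by
          refine Finset.mem_filter.2 ⟨?_, not_le.1 hc⟩
          simp
        exact absurd (htmax _ this) (not_le.2 h3)
      · exfalso
        have h4 := hl j (h2.trans_lt htx)
        have : s j + 3533 / 50000 * p j ∈ E := by
          refine Finset.mem_filter.2 ⟨?_, h4⟩
          simp
        exact absurd (htmax _ this) (not_le.2 h3)
    choose z hz1 hz2 using hz
    refine ⟨x, ∅, by simp, by simp, le_rfl, Or.inr ⟨hrx, z, fun M N hMN => ?_, hz2⟩⟩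
    rw [← hz1 M, hMN, hz1 N]

/-- All jobs together have length at most `3 T`, so a chain of locks spans at most `3 α T`. A chain
reaching back from such an `x` therefore stops after the release of `Y`, at busy machines. -/
lemma exists_chain [Fintype J] (h : Comparison r p s q μ ν T) (Y : J) {x : ℝ}
    (hx : r Y + 3 * (3533 / 50000) * T < x) (hxs : x ≤ s Y) :
    ∃ (τ : ℝ) (Q : Finset J) (z : Fin 3 → J), (∀ j ∈ Q, τ ≤ s j ∧ s j < x) ∧
      x ≤ τ + 3533 / 50000 * ∑ j ∈ Q, p j ∧ τ ≤ x ∧ r Y < τ ∧ Function.Injective z ∧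
        ∀ M, s (z M) < τ ∧ τ ≤ s (z M) + p (z M) := by
  have hT : 0 ≤ T := (h.p_pos Y).le.trans (h.p_le Y)
  obtain ⟨τ, Q, h1, h2, h3, h4 | ⟨h4, z, h5, h6⟩⟩ :=
    h.exists_chain_aux Y _ x rfl (by linarith) hxs
  · exfalso
    have h5 : ∑ j ∈ Q, p j ≤ ∑ j, p j :=
      Finset.sum_le_sum_of_subset_of_nonneg (Finset.subset_univ _) fun j _ _ => (h.p_pos j).le
    linarith [h.sum_p_le hT]
  · exact ⟨τ, Q, z, h1, h2, h3, h4, h5, h6⟩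

/-- Take the largest candidate among `0` and the release times that has all properties but the last.
Were a machine idle at a later `t` before `ℓ` starts, every job started from `t` on would be
released after `t`; the first such release would be a larger candidate, as the idle machine carries
no job across it. -/
lemma exists_isCriticalTime [Fintype J] (h : Comparison r p s q μ ν T) (ℓ : J) :
    ∃ c : ℝ, IsCriticalTime r p s μ ℓ c := by
  classical
  let P : ℝ → Prop := fun c => 0 ≤ c ∧ c ≤ r ℓ ∧ (∀ j, c ≤ s j → c ≤ r j) ∧
      (∀ j, s j < c → s j + 3533 / 50000 * p j ≤ c) ∧ {j | s j < c ∧ c < s j + p j}.ncard ≤ 2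
  let E : Finset ℝ := (insert 0 (Finset.univ.image r)).filter P
  have h0 : P 0 := by
    refine ⟨le_rfl, h.r_nonneg ℓ, fun j _ => h.r_nonneg j, fun j hj => ?_, ?_⟩
    · linarith [h.start_nonneg j]
    · have : {j | s j < 0 ∧ 0 < s j + p j} = ∅ := by
        ext j
        simp only [Set.mem_ofPred_eq, Set.mem_empty_iff_false, iff_false]
        exact fun hj => by linarith [h.start_nonneg j, hj.1]
      rw [this]
      simp
  have h0E : (0 : ℝ) ∈ E := Finset.mem_filter.2 ⟨by simp, h0⟩
  obtain ⟨c, hcE, hmax⟩ := E.exists_max_image id ⟨_, h0E⟩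
  obtain ⟨hc1, hc2, hc3, hc4, hc5⟩ := (Finset.mem_filter.1 hcE).2
  refine ⟨c, hc1, hc2, hc3, hc4, hc5, fun t hct ht => ?_⟩
  by_contra hid
  simp only [NonIdle, not_forall, not_or, not_exists, not_and, not_lt] at hid
  obtain ⟨M, hM, hL⟩ := hid
  have hp : ∀ j, t ≤ s j → t < r j := by
    intro j hj
    by_contra hr
    rcases eq_or_lt_of_le hj with hj | hj
    · have := hL j hj.ge
      linarith [h.p_pos j]
    · rcases h.nonIdle j t (not_lt.1 hr) hj M with ⟨k, hk, h1, h2⟩ | ⟨k, h1, h2⟩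
      · exact absurd (hM k hk h1) (not_le.2 h2)
      · exact absurd (hL k h1) (not_le.2 h2)
  have hne : (Finset.univ.filter fun j => t ≤ s j).Nonempty := ⟨ℓ, by simp [ht.le]⟩
  obtain ⟨i, hi, hmin⟩ := Finset.exists_min_image _ r hne
  have hti : t < r i := hp i (Finset.mem_filter.1 hi).2
  have hmin' : ∀ j, t ≤ s j → r i ≤ r j := fun j hj => hmin j (by simp [hj])
  have hbefore : ∀ j, s j < r i → s j < t := fun j hj => by
    by_contra hc
    exact absurd ((hmin' j (not_lt.1 hc)).trans (h.release_le j)) (not_le.2 hj)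
  have hPi : P (r i) := by
    refine ⟨h.r_nonneg i, hmin' ℓ ht.le, fun j hj => hmin' j (hti.le.trans hj),
      fun j hj => (hL j (hbefore j hj).le).trans hti.le, ?_⟩
    have hmaps : Set.MapsTo μ {j | s j < r i ∧ r i < s j + p j} ({M}ᶜ : Set (Fin 3)) := by
      intro j hj hjM
      have h1 := hM j hjM (hbefore j hj.1).le
      linarith [hj.2]
    have hinj : Set.InjOn μ {j | s j < r i ∧ r i < s j + p j} := by
      intro j hj k hk hjk
      by_contra hne
      rcases h.disj j k hne hjk with h1 | h1
      · linarith [hj.2, hk.1]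
      · linarith [hk.2, hj.1]
    refine (Set.ncard_le_ncard_of_injOn μ hmaps hinj (Set.toFinite _)).trans ?_
    rw [Set.ncard_compl]
    simp
  have hiE : r i ∈ E := Finset.mem_filter.2 ⟨by simp, hPi⟩
  have := hmax _ hiE
  simp only [id] at this
  linarith

end Comparison

/-! ### Existence of SLEEPY schedules, and reduction to a comparison. -/

/-- The SLEEPY rule can be followed from any state of the machines: `avail M` is the time from
which machine `M` is free, and all machines are locked until `L`. -/
lemma exists_sleepy_aux {J : Type*} (I : JobSet J) {α : ℝ} (hα : 0 ≤ α) (n : ℕ) :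
    ∀ (U : Finset J) (avail : Fin 3 → ℝ) (L : ℝ), U.card = n →
    ∃ (s : J → ℝ) (μ : J → Fin 3),
      (∀ j ∈ U, I.r j ≤ s j ∧ avail (μ j) ≤ s j ∧ L ≤ s j) ∧
      (∀ i ∈ U, ∀ j ∈ U, i ≠ j → μ i = μ j → s i + I.p i ≤ s j ∨ s j + I.p j ≤ s i) ∧
      (∀ i ∈ U, ∀ j ∈ U, i ≠ j → s i ≤ s j → s i + α * I.p i ≤ s j) ∧
      (∀ i ∈ U, ∀ j ∈ U, I.r i ≤ s j → s j < s i → I.p i ≤ I.p j) ∧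
      ∀ t M, avail M ≤ t → L ≤ t → (∀ j ∈ U, μ j = M → s j ≤ t → s j + I.p j ≤ t) →
        (∀ j ∈ U, s j ≤ t → s j + α * I.p j ≤ t) → ∀ j ∈ U, I.r j ≤ t → s j ≤ t := by
  classical
  induction n with
  | zero =>
    intro U avail L hU
    rw [Finset.card_eq_zero] at hU
    subst hU
    exact ⟨fun _ => 0, fun _ => 0, by simp⟩
  | succ n ih =>
    intro U avail L hU
    have hne : U.Nonempty := by
      rw [← Finset.card_pos]
      omega
    obtain ⟨M₀, -, hM₀⟩ := Finset.exists_min_image Finset.univ avail Finset.univ_nonempty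
    obtain ⟨j₀, hj₀, hmin⟩ := Finset.exists_min_image U I.r hne
    -- The first moment at which the rule can act: a machine is free, the lock is over and a job is
    -- released.
    obtain ⟨t₀, ht₀⟩ : ∃ t, t = max (max (avail M₀) L) (I.r j₀) := ⟨_, rfl⟩
    have h1 : avail M₀ ≤ t₀ := ht₀ ▸ (le_max_left _ _).trans (le_max_left _ _)
    have h2 : L ≤ t₀ := ht₀ ▸ (le_max_right _ _).trans (le_max_left _ _)
    have h3 : I.r j₀ ≤ t₀ := ht₀ ▸ le_max_right _ _
    obtain ⟨k, hk, hkmax⟩ := Finset.exists_max_image (U.filter fun j => I.r j ≤ t₀) I.p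
      ⟨j₀, Finset.mem_filter.2 ⟨hj₀, h3⟩⟩
    rw [Finset.mem_filter] at hk
    have hpk := I.p_pos k
    have hαp : 0 ≤ α * I.p k := by positivity
    obtain ⟨s, μ, a1, a2, a3, a4, a5⟩ := ih (U.erase k)
      (Function.update avail M₀ (t₀ + I.p k)) (t₀ + α * I.p k) (by
        rw [Finset.card_erase_of_mem hk.1, hU]
        rfl)
    have hs : ∀ j, j ≠ k → Function.update s k t₀ j = s j := fun j hj =>
      Function.update_of_ne hj _ _
    have hμ : ∀ j, j ≠ k → Function.update μ k M₀ j = μ j := fun j hj =>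
      Function.update_of_ne hj _ _
    have hsk : Function.update s k t₀ k = t₀ := Function.update_self _ _ _
    have hμk : Function.update μ k M₀ k = M₀ := Function.update_self _ _ _
    have hmem : ∀ j ∈ U, j ≠ k → j ∈ U.erase k := fun j hj hjk =>
      Finset.mem_erase.2 ⟨hjk, hj⟩
    have hlate : ∀ j ∈ U, j ≠ k → t₀ + α * I.p k ≤ s j := fun j hj hjk =>
      (a1 j (hmem j hj hjk)).2.2
    have hbusy : ∀ j ∈ U, j ≠ k → μ j = M₀ → t₀ + I.p k ≤ s j := fun j hj hjk hjM => by
      have := (a1 j (hmem j hj hjk)).2.1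
      rwa [hjM, Function.update_self] at this
    refine ⟨Function.update s k t₀, Function.update μ k M₀, ?_, ?_, ?_, ?_, ?_⟩
    · intro j hj
      by_cases hjk : j = k
      · subst hjk
        rw [hsk, hμk]
        exact ⟨hk.2, h1, h2⟩
      · rw [hs j hjk, hμ j hjk]
        have := a1 j (hmem j hj hjk)
        refine ⟨this.1, ?_, by linarith [hlate j hj hjk]⟩
        by_cases hjM : μ j = M₀
        · linarith [hbusy j hj hjk hjM, hjM ▸ h1]
        · rw [Function.update_of_ne hjM] at this
          exact this.2.1
    · intro i hi j hj hij hm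
      by_cases hik : i = k
      · subst hik
        rw [hsk, hs j hij.symm]
        rw [hμk, hμ j hij.symm] at hm
        exact Or.inl (hbusy j hj hij.symm hm.symm)
      · by_cases hjk : j = k
        · subst hjk
          rw [hsk, hs i hij]
          rw [hμk, hμ i hij] at hm
          exact Or.inr (hbusy i hi hij hm)
        · rw [hs i hik, hs j hjk]
          rw [hμ i hik, hμ j hjk] at hm
          exact a2 i (hmem i hi hik) j (hmem j hj hjk) hij hm
    · intro i hi j hj hij hle
      by_cases hik : i = k
      · subst hik
        rw [hsk, hs j hij.symm]
        exact hlate j hj hij.symm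
      · by_cases hjk : j = k
        · subst hjk
          rw [hsk, hs i hij] at hle
          have h4 := hlate i hi hij
          have h5 : α * I.p j = 0 := by linarith
          rcases mul_eq_zero.1 h5 with h6 | h6
          · subst h6
            rw [hsk, hs i hij]
            simpa using hle
          · linarith
        · rw [hs i hik, hs j hjk] at *
          exact a3 i (hmem i hi hik) j (hmem j hj hjk) hij hle
    · intro i hi j hj hr hlt
      by_cases hjk : j = k
      · subst hjk
        rw [hsk] at hr
        exact hkmax i (Finset.mem_filter.2 ⟨hi, hr⟩)
      · by_cases hik : i = k
        · subst hik
          rw [hsk, hs j hjk] at hlt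
          linarith [hlate j hj hjk]
        · rw [hs j hjk] at hr hlt
          rw [hs i hik] at hlt
          exact a4 i (hmem i hi hik) j (hmem j hj hjk) hr hlt
    · intro t M hM hL hb hl j hj hrj
      have htt : t₀ ≤ t := by
        rw [ht₀]
        exact max_le (max_le ((hM₀ M (Finset.mem_univ _)).trans hM) hL) ((hmin j hj).trans hrj)
      by_cases hjk : j = k
      · subst hjk
        rwa [hsk]
      · rw [hs j hjk]
        have hlk := hl k hk.1
        rw [hsk] at hlk
        refine a5 t M ?_ (hlk htt) ?_ ?_ j (hmem j hj hjk) hrj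
        · by_cases hMM : M = M₀
          · subst hMM
            rw [Function.update_self]
            have := hb k hk.1 hμk
            rw [hsk] at this
            exact this htt
          · rwa [Function.update_of_ne hMM]
        · intro i hi hiM hit
          have hik := (Finset.mem_erase.1 hi).1
          have := hb i (Finset.mem_erase.1 hi).2
          rw [hs i hik, hμ i hik] at this
          exact this hiM hit
        · intro i hi hit
          have hik := (Finset.mem_erase.1 hi).1
          have := hl i (Finset.mem_erase.1 hi).2
          rw [hs i hik] at this
          exact this hit

namespace JobSet

lemma lockParam_one {J : Type*} {m : ℕ} (α : ℝ) (I : JobSet J) (S : Schedule m J) (j : J) :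
    lockParam 1 α I S j = α := by
  simp [lockParam]

lemma exists_isGeneralizedSleepy {J : Type*} [Fintype J] (I : JobSet J) {α : ℝ} (hα : 0 ≤ α) :
    ∃ S : Schedule 3 J, I.IsGeneralizedSleepy 1 α S := by
  obtain ⟨s, μ, a1, a2, a3, a4, a5⟩ :=
    exists_sleepy_aux I hα _ Finset.univ (fun _ => 0) 0 rfl
  refine ⟨⟨s, μ⟩, ⟨⟨fun j => (a1 j (Finset.mem_univ _)).1, fun i j hij hm =>
    a2 i (Finset.mem_univ _) j (Finset.mem_univ _) hij hm⟩, ?_, ?_, ?_⟩⟩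
  · rintro i j hij ⟨h1, h2⟩
    rw [lockParam_one] at h2
    have := a3 i (Finset.mem_univ _) j (Finset.mem_univ _) hij h1
    simp only at h2
    linarith
  · rintro i j ⟨h1, h2⟩
    exact a4 i (Finset.mem_univ _) j (Finset.mem_univ _) h1 h2
  · rintro t M ⟨h1, h2⟩ j ⟨h3, h4⟩
    have h0 : 0 ≤ t := (I.r_nonneg j).trans h3
    refine absurd (a5 t M h0 h0 ?_ ?_ j (Finset.mem_univ _) h3) (not_le.2 h4)
    · intro i _ hi hit
      by_contra hc
      exact h1 ⟨i, hi, hit, not_le.1 hc⟩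
    · intro i _ hit
      by_contra hc
      refine h2 ⟨i, hit, ?_⟩
      rw [lockParam_one]
      exact not_le.1 hc

lemma IsGeneralizedSleepy.comparison {J : Type*} {I : JobSet J} {S O : Schedule 3 J} {T : ℝ}
    (hS : I.IsGeneralizedSleepy 1 0.07066 S) (hO : I.Feasible O)
    (hT : ∀ j, I.completion O j ≤ T) :
    Comparison I.r I.p S.s O.s S.machine O.machine T where
  r_nonneg := I.r_nonneg
  p_pos := I.p_pos
  release_le := hS.feasible.1
  disj := hS.feasible.2
  lock i j hij := by
    have := hS.not_locked i j (fun hh => by rw [hh] at hij; exact lt_irrefl _ hij)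
    rw [LockedBy, lockParam_one] at this
    have h1 := not_and.1 this hij.le
    norm_num at h1
    linarith
  start_inj i j hij := by
    by_contra hne
    have := hS.not_locked i j hne
    rw [LockedBy, lockParam_one] at this
    have h1 := not_and.1 this hij.le
    have := I.p_pos i
    norm_num at h1
    linarith
  longest i j h1 h2 := hS.longest i j ⟨h1, h2⟩
  nonIdle i t h1 h2 M := by
    by_contra hc
    rw [not_or] at hc
    refine hS.greedy t M ⟨hc.1, fun ⟨j, hj1, hj2⟩ => hc.2 ⟨j, hj1, ?_⟩⟩ i ⟨h1, h2⟩
    rw [lockParam_one] at hj2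
    norm_num at hj2
    linarith
  release_le_off := hO.1
  disj_off := hO.2
  deadline := hT

lemma makespan_le_mul_opt {J : Type*} [Fintype J] {I : JobSet J} {S : Schedule 3 J} {c : ℝ}
    (hc : 0 < c) (hS : I.Feasible S)
    (h : ∀ (O : Schedule 3 J) (T : ℝ), I.Feasible O → (∀ j, I.completion O j ≤ T) →
      ∀ j, I.completion S j ≤ c * T) :
    I.makespan S ≤ c * I.opt 3 := by
  rw [← div_le_iff₀' hc]
  refine le_csInf ⟨_, S, hS, rfl⟩ ?_
  rintro _ ⟨O, hO, rfl⟩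
  rw [div_le_iff₀' hc]
  rcases isEmpty_or_nonempty J with hJ | hJ
  · simp [makespan]
  · exact ciSup_le fun j => h O _ hO (fun i => le_ciSup (f := I.completion O)
      (Set.finite_range _).bddAbove i) j

end JobSet

/-! ### Long jobs that wait for long. -/

lemma fin_three_cover : ∀ {a b c : Fin 3}, a ≠ b → a ≠ c → b ≠ c → ∀ x, x = a ∨ x = b ∨ x = c := by
  decide

lemma fin_three_rest : ∀ {a b x y : Fin 3}, a ≠ b → x ≠ a → x ≠ b → y ≠ a → y ≠ b → x = y := by
  decide

lemma fin_three_exists_other : ∀ a b : Fin 3, ∃ c, c ≠ a ∧ c ≠ b := by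
  decide

lemma exists_ne_map_eq_of_two_values {β : Type*} {f : Fin 3 → β} {a b : β}
    (h : ∀ M, f M = a ∨ f M = b) : ∃ M N, M ≠ N ∧ f M = f N := by
  rcases h 0 with h0 | h0 <;> rcases h 1 with h1 | h1
  · exact ⟨0, 1, by decide, h0.trans h1.symm⟩
  · rcases h 2 with h2 | h2
    · exact ⟨0, 2, by decide, h0.trans h2.symm⟩
    · exact ⟨1, 2, by decide, h1.trans h2.symm⟩
  · rcases h 2 with h2 | h2
    · exact ⟨1, 2, by decide, h1.trans h2.symm⟩
    · exact ⟨0, 2, by decide, h0.trans h2.symm⟩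
  · exact ⟨0, 1, by decide, h0.trans h1.symm⟩

lemma exists_not_mem_pair {J : Type*} {z : Fin 3 → J} (hz : Function.Injective z) (x y : J) :
    ∃ M, z M ≠ x ∧ z M ≠ y := by
  by_contra! hh
  obtain ⟨M, N, hMN, hν⟩ := exists_ne_map_eq_of_two_values (f := z) (a := x) (b := y)
    fun M => or_iff_not_imp_left.2 (hh M)
  exact hMN (hz hν)

namespace Comparison

variable {J : Type*} {r p s q : J → ℝ} {μ ν : J → Fin 3} {T : ℝ}

lemma T_pos (h : Comparison r p s q μ ν T) (j : J) : 0 < T := (h.p_pos j).trans_le (h.p_le j)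

lemma ne_of_start_lt {i j : J} (hij : s i < s j) : i ≠ j := by
  rintro rfl
  exact lt_irrefl _ hij

lemma exists_three_of_two_lt_card {Q : Finset J} (hQ : 2 < Q.card) :
    ∃ a ∈ Q, ∃ b ∈ Q, ∃ c ∈ Q, a ≠ b ∧ a ≠ c ∧ b ≠ c := by
  obtain ⟨a, b, c, ha, hb, hc, h⟩ := Finset.two_lt_card_iff.1 hQ
  exact ⟨a, ha, b, hb, c, hc, h⟩

/-- If a long job `Y` waits for long, then just before its start the machines are locked by a
chain `Q` of long jobs, and before this chain they are processing three fairly long jobs. -/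
lemma exists_heavy [Fintype J] (h : Comparison r p s q μ ν T) {Y : J} {δ : ℝ}
    (hδ : 3 * (3533 / 50000) * T ≤ δ) (hp : δ < p Y) (hd : r Y + δ < s Y) :
    ∃ (τ : ℝ) (Q : Finset J) (z : Fin 3 → J),
      (∀ j ∈ Q, δ < p j ∧ τ ≤ s j ∧ s j < s Y) ∧
      s Y ≤ τ + 3533 / 50000 * ∑ j ∈ Q, p j ∧ τ ≤ s Y ∧ r Y < τ ∧ Function.Injective z ∧
      ∀ M, s (z M) < τ ∧ τ ≤ s (z M) + p (z M) ∧
        δ - 3533 / 50000 * ∑ j ∈ Q, p j < p (z M) := by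
  obtain ⟨τ, Q, z, h1, h2, h3, h4, h5, h6⟩ := h.exists_chain Y (by linarith) le_rfl
  have h7 : 0 ≤ ∑ j ∈ Q, p j := Finset.sum_nonneg fun j _ => (h.p_pos j).le
  refine ⟨τ, Q, z, fun j hj => ⟨?_, h1 j hj⟩, h2, h3, h4, h5, fun M =>
    ⟨(h6 M).1, (h6 M).2, ?_⟩⟩
  · have := h.longest Y j (by linarith [(h1 j hj).1]) (h1 j hj).2
    linarith
  -- A job started since the release of `Y` was preferred to `Y`; an older one has been running from
  -- before that release up to `τ`.
  · rcases le_or_gt (r Y) (s (z M)) with h8 | h8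
    · have := h.longest Y (z M) h8 ((h6 M).1.trans_le h3)
      linarith
    · linarith [(h6 M).2]

/-- A long job cannot wait for long if the jobs leave room for an extra load `β` on each machine
of the offline schedule. -/
lemma false_of_heavy [Fintype J] (h : Comparison r p s q μ ν T) {Y : J} {δ β : ℝ}
    (hδ : 3 * (3533 / 50000) * T ≤ δ) (hp : δ < p Y) (hd : r Y + δ < s Y)
    (hone : ∀ i, s i ≤ s Y → p i + β ≤ T)
    (hpair : ∀ i j, i ≠ j → ν i = ν j → s i ≤ s Y → s j ≤ s Y → p i + p j + β ≤ T)
    (n2 : 2 * (3533 / 50000) * (T - β - δ) < (1 - 2 * (3533 / 50000)) * (2 * δ + β - T))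
    (n3 : T < 3 * (δ - 2 * (3533 / 50000) * (T - β))) : False := by
  classical
  have hT := h.T_pos Y
  obtain ⟨τ, Q, z, hQ, -, hτ, -, hz, hz'⟩ := h.exists_heavy hδ hp hd
  have hzs : ∀ M, s (z M) < s Y := fun M => (hz' M).1.trans_le hτ
  have hzi : ∀ M, z M ≠ Y := fun M => ne_of_start_lt (hzs M)
  have hzQ : ∀ M, ∀ j ∈ Q, z M ≠ j := fun M j hj =>
    ne_of_start_lt ((hz' M).1.trans_le (hQ j hj).2.1)
  have hpY := hone Y le_rfl
  have hQone : ∀ j ∈ Q, p j + β ≤ T := fun j hj => hone j (hQ j hj).2.2.le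
  have hsolo : ∀ j ∈ Q, ν j ≠ ν Y := fun j hj hν => by
    linarith [hpair j Y (ne_of_start_lt (hQ j hj).2.2) hν (hQ j hj).2.2.le le_rfl, (hQ j hj).1]
  have hsolo' : ∀ j ∈ Q, ∀ k ∈ Q, j ≠ k → ν j ≠ ν k := fun j hj k hk hjk hν => by
    linarith [hpair j k hjk hν (hQ j hj).2.2.le (hQ k hk).2.2.le, (hQ j hj).1, (hQ k hk).1]
  have hzpair : ∀ M N, M ≠ N → ν (z M) = ν (z N) → p (z M) + p (z N) + β ≤ T :=
    fun M N hMN hν => hpair _ _ (hz.ne hMN) hν (hzs M).le (hzs N).le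
  have h01 : z 0 ≠ z 1 := hz.ne (by decide)
  have h02 : z 0 ≠ z 2 := hz.ne (by decide)
  have h12 : z 1 ≠ z 2 := hz.ne (by decide)
  rcases Nat.lt_or_ge 2 Q.card with hc | hc
  -- The chain jobs and `Y` lie on pairwise different offline machines, so the chain has at most two
  -- jobs.
  · obtain ⟨a, ha, b, hb, c, hc, hab, hac, hbc⟩ := exists_three_of_two_lt_card hc
    rcases fin_three_cover (hsolo' a ha b hb hab) (hsolo' a ha c hc hac) (hsolo' b hb c hc hbc)
      (ν Y) with h1 | h1 | h1
    · exact hsolo a ha h1.symm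
    · exact hsolo b hb h1.symm
    · exact hsolo c hc h1.symm
  interval_cases hcard : Q.card
  · rw [Finset.card_eq_zero] at hcard
    subst hcard
    simp only [Finset.sum_empty, mul_zero, sub_zero] at hz'
    have hinj : Function.Injective fun M => ν (z M) := fun M N hMN => by
      by_contra hne
      linarith [hzpair M N hne hMN, (hz' M).2.2, (hz' N).2.2]
    obtain ⟨M, hM⟩ := Finite.injective_iff_surjective.1 hinj (ν Y)
    linarith [hpair _ _ (hzi M) hM (hzs M).le le_rfl, (hz' M).2.2]
  · obtain ⟨a, rfl⟩ := Finset.card_eq_one.1 hcard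
    simp only [Finset.mem_singleton, forall_eq, Finset.sum_singleton] at *
    have h1 : ∀ M, ν (z M) ≠ ν Y := fun M hM => by
      linarith [hpair _ _ (hzi M) hM (hzs M).le le_rfl, (hz' M).2.2]
    have h2 : ∀ M, ν (z M) ≠ ν a := fun M hM => by
      linarith [hpair _ _ (hzQ M) hM (hzs M).le hQ.2.2.le, (hz' M).2.2]
    have h3 := fun M N => fin_three_rest hsolo (h2 M) (h1 M) (h2 N) (h1 N)
    linarith [h.triple_le h01 h02 h12 (h3 0 1) (h3 0 2), (hz' 0).2.2, (hz' 1).2.2, (hz' 2).2.2]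
  · obtain ⟨a, b, hab, rfl⟩ := Finset.card_eq_two.1 hcard
    have ha : a ∈ ({a, b} : Finset J) := by simp
    have hb : b ∈ ({a, b} : Finset J) := by simp
    rw [Finset.sum_pair hab] at hz'
    have hpa := hQone a ha
    have hpb := hQone b hb
    have hcov := fin_three_cover (hsolo' a ha b hb hab) (hsolo a ha) (hsolo b hb)
    have hinj : Function.Injective fun M => ν (z M) := fun M N hMN => by
      by_contra hne
      obtain ⟨x, hx1, hx2, hx3, hx4⟩ : ∃ x, δ < p x ∧ ν (z M) = ν x ∧ z M ≠ x ∧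
          z N ≠ x := by
        rcases hcov (ν (z M)) with h1 | h1 | h1
        · exact ⟨a, (hQ a ha).1, h1, hzQ M a ha, hzQ N a ha⟩
        · exact ⟨b, (hQ b hb).1, h1, hzQ M b hb, hzQ N b hb⟩
        · exact ⟨Y, hp, h1, hzi M, hzi N⟩
      linarith [h.triple_le (hz.ne hne) hx3 hx4 hMN hx2, (hz' M).2.2, (hz' N).2.2]
    -- Each offline machine holds one of `a`, `b`, `Y` and exactly one of the `z M`; the three pair
    -- bounds together are too tight.
    have hsur := Finite.injective_iff_surjective.1 hinj
    obtain ⟨M, hM⟩ := hsur (ν Y)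
    obtain ⟨N, hN⟩ := hsur (ν a)
    obtain ⟨K, hK⟩ := hsur (ν b)
    linarith [hpair _ _ (hzi M) hM (hzs M).le le_rfl, (hz' M).2.2,
      hpair _ _ (hzQ N a ha) hN (hzs N).le (hQ a ha).2.2.le, (hz' N).2.2,
      hpair _ _ (hzQ K b hb) hK (hzs K).le (hQ b hb).2.2.le, (hz' K).2.2]

/-- No job longer than `0.54 T` waits for longer than `0.54 T`. -/
lemma wait_le_of_long [Fintype J] (h : Comparison r p s q μ ν T) {i : J}
    (hp : 27 / 50 * T < p i) : s i ≤ r i + 27 / 50 * T := by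
  by_contra! hd
  have hT := h.T_pos i
  -- For `β = 0` the condition `n2` reads `T < 1.85868 δ`, that is `δ > 0.5380… T`; hence the value
  -- `0.54`.
  exact h.false_of_heavy (β := 0) (by linarith) hp hd (fun j _ => by linarith [h.p_le j])
    (fun j k hjk hν _ _ => by linarith [h.pair_le hjk hν]) (by linarith) (by linarith)

end Comparison

/-! ### Work before and after the critical time. -/

namespace Comparison

variable {J : Type*} [Fintype J] {r p s q : J → ℝ} {μ ν : J → Fin 3} {T : ℝ} {ℓ : J} {c : ℝ}

open scoped Classical in
/-- The work that is done from a critical time `c` until the start of `ℓ`. -/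
lemma load_from_critical (h : Comparison r p s q μ ν T) (hc : IsCriticalTime r p s μ ℓ c) :
    3 * (s ℓ - c) ≤ ∑ j with s j < c ∧ c < s j + p j, (s j + p j - c) +
      (1 + 2 * (3533 / 50000)) * ∑ j with c ≤ s j ∧ s j < s ℓ, p j := by
  refine (h.load hc.nonIdle).trans ?_
  rw [Finset.mul_sum, Finset.sum_filter, Finset.sum_filter, ← Finset.sum_add_distrib]
  refine Finset.sum_le_sum fun j _ => ?_
  have hp := h.p_pos j
  have h1 := min_le_left (s j + p j) (s ℓ)
  have h2 := le_max_right (s j) c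
  rcases lt_or_ge (s j) c with h3 | h3
  · rw [overlap_eq_zero_of_le (hc.lock j h3),
      if_neg (c := c ≤ s j ∧ s j < s ℓ) (fun hh => absurd hh.1 (not_le.2 h3))]
    split_ifs with h4
    · have := overlap_le (b := s j + p j - c) (by linarith [h4.2])
        (show min (s j + p j) (s ℓ) - max (s j) c ≤ _ by linarith)
      linarith
    · rw [overlap_eq_zero_of_le (by by_contra! h5; exact h4 ⟨h3, h5⟩)]
      simp
  · rw [if_neg (fun hh => absurd hh.1 (not_lt.2 h3))]
    rcases lt_or_ge (s j) (s ℓ) with h4 | h4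
    · rw [if_pos ⟨h3, h4⟩]
      have h5 := overlap_le_length (x := c) (y := s ℓ) (show s j ≤ s j + p j by linarith)
      have h6 := overlap_le_length (x := c) (y := s ℓ)
        (show s j ≤ s j + 3533 / 50000 * p j by linarith)
      linarith
    · rw [if_neg (fun hh => absurd hh.2 (not_lt.2 h4)), overlap_eq_zero_of_ge h4,
        overlap_eq_zero_of_ge h4]
      simp

open scoped Classical in
-- A job carried across `c` can be processed offline before `c` only between its release and `c`;
-- jobs started online from `c` on are released from `c` on and count in full.
lemma offline_load_from_critical (h : Comparison r p s q μ ν T)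
    (hc : IsCriticalTime r p s μ ℓ c) :
    ∑ j with s j < c ∧ c < s j + p j, max 0 (p j - (c - r j)) +
      ∑ j with c ≤ s j ∧ s j < s ℓ, p j + p ℓ ≤ 3 * (T - c) := by
  have hcT : c ≤ T := by linarith [hc.le_release, h.release_add_le ℓ, h.p_pos ℓ]
  refine le_trans ?_ (h.offline_load hcT)
  have h0 : p ℓ = ∑ j, if j = ℓ then p j else 0 := by simp
  rw [h0, Finset.sum_filter, Finset.sum_filter, ← Finset.sum_add_distrib,
    ← Finset.sum_add_distrib]
  refine Finset.sum_le_sum fun j _ => ?_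
  have hp := h.p_pos j
  have hfull : c ≤ s j → overlap c T (q j) (q j + p j) = p j := fun hj => by
    rw [overlap_eq_length (by linarith) ((hc.release j hj).trans (h.release_le_off j))
      (h.deadline j)]
    ring
  have hn := overlap_nonneg c T (q j) (q j + p j)
  by_cases hjl : j = ℓ
  · subst hjl
    have h1 := hc.le_release.trans (h.release_le j)
    rw [hfull h1, if_neg (fun hh => absurd hh.1 (not_lt.2 h1)), if_neg (fun hh => lt_irrefl _ hh.2),
      if_pos rfl]
    simp
  · rw [if_neg hjl]
    rcases lt_or_ge (s j) c with h3 | h3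
    · rw [if_neg (c := c ≤ s j ∧ s j < s ℓ) (fun hh => absurd hh.1 (not_le.2 h3))]
      split_ifs
      · simp only [add_zero]
        refine max_le hn (le_trans ?_ (le_overlap _ _ _ _))
        rw [min_eq_left (h.deadline j)]
        rcases max_cases (q j) c with ⟨h4, -⟩ | ⟨h4, -⟩ <;> rw [h4]
        · have := h.release_le j
          linarith [h.release_le_off j]
        · linarith [h.release_le_off j]
      · simpa using hn
    · rw [if_neg (fun hh => absurd hh.1 (not_lt.2 h3)), hfull h3]
      split_ifs <;> simp [hp.le]

open scoped Classical in
lemma total_load_critical (h : Comparison r p s q μ ν T) (hc : IsCriticalTime r p s μ ℓ c) :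
    ∑ j with s j + p j ≤ c, p j + ∑ j with s j < c ∧ c < s j + p j, p j +
      ∑ j with c ≤ s j ∧ s j < s ℓ, p j + p ℓ ≤ 3 * T := by
  refine le_trans ?_ (h.sum_p_le (h.T_pos ℓ).le)
  have h0 : p ℓ = ∑ j, if j = ℓ then p j else 0 := by simp
  rw [h0, Finset.sum_filter, Finset.sum_filter, Finset.sum_filter, ← Finset.sum_add_distrib,
    ← Finset.sum_add_distrib, ← Finset.sum_add_distrib]
  refine Finset.sum_le_sum fun j _ => ?_
  have hp := h.p_pos j
  have hl := hc.le_release.trans (h.release_le ℓ)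
  by_cases hjl : j = ℓ
  · subst hjl
    rw [if_neg (by linarith), if_neg (fun hh => absurd hh.1 (not_lt.2 hl)),
      if_neg (fun hh => lt_irrefl _ hh.2)]
    simp
  · rw [if_neg hjl]
    split_ifs <;> linarith

open scoped Classical in
/-- The work that is done before time `c` while a job `i` is waiting. -/
lemma wait_load_before (h : Comparison r p s q μ ν T) {i : J}
    (hi : s i < c) :
    3 * (s i - r i) ≤ (1 + 2 * (3533 / 50000)) * ∑ j with s j + p j ≤ c, p j +
      ∑ j with s j < c ∧ c < s j + p j,
        if s j < s i then s i - s j + 2 * (3533 / 50000) * p j else 0 := by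
  refine (h.load (h.nonIdle i)).trans ?_
  rw [Finset.mul_sum, Finset.sum_filter, Finset.sum_filter, ← Finset.sum_add_distrib]
  refine Finset.sum_le_sum fun j _ => ?_
  have hp := h.p_pos j
  have h5 := overlap_le_length (x := r i) (y := s i) (show s j ≤ s j + p j by linarith)
  have h6 := overlap_le_length (x := r i) (y := s i)
    (show s j ≤ s j + 3533 / 50000 * p j by linarith)
  rcases lt_or_ge (s j) (s i) with h3 | h3
  · rw [if_pos h3]
    rcases le_or_gt (s j + p j) c with h4 | h4
    · rw [if_pos h4, if_neg (fun hh => absurd hh.2 (not_lt.2 h4))]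
      linarith
    · rw [if_neg (not_le.2 h4), if_pos ⟨by linarith, h4⟩]
      have := overlap_le (x := r i) (y := s i) (u := s j) (v := s j + p j) (b := s i - s j)
        (by linarith) (by linarith [min_le_right (s j + p j) (s i), le_max_left (s j) (r i)])
      linarith
  · rw [overlap_eq_zero_of_ge h3, overlap_eq_zero_of_ge h3, if_neg (not_lt.2 h3)]
    split_ifs <;> simp <;> positivity

/-- The linear arithmetic for two carried jobs, `i` being the one that waited longer. The work that
a carried job leaves after `c` exceeds its offline share by at most its waiting time. Both waits are
at most that of `i`, which needs enough work before `c` (`h4`), and all work is at most `3 T`. -/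
lemma critical_numeric {T c p PN PF s sᵢ pᵢ rᵢ wᵢ sₖ pₖ rₖ wₖ : ℝ}
    (hp : 0 < p) (hviol : 14817 / 10000 * T < s + p)
    (h1 : 3 * (s - c) ≤ (sᵢ + pᵢ - c) + (sₖ + pₖ - c) + (1 + 2 * (3533 / 50000)) * PN)
    (h2 : wᵢ + wₖ + PN + p ≤ 3 * (T - c))
    (h3 : PF + (pᵢ + pₖ) + PN + p ≤ 3 * T)
    (hwᵢ : pᵢ - (c - rᵢ) ≤ wᵢ) (hwₖ : pₖ - (c - rₖ) ≤ wₖ)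
    (hwᵢ' : 0 ≤ wᵢ) (hwₖ' : 0 ≤ wₖ) (hsᵢ : sᵢ < c) (hsₖ : sₖ < c) (hrₖ : 0 ≤ rₖ)
    (hd : sₖ - rₖ ≤ sᵢ - rᵢ)
    (h4 : 3 * (sᵢ - rᵢ) ≤ (1 + 2 * (3533 / 50000)) * PF ∨
      (3 * (sᵢ - rᵢ) ≤ (1 + 2 * (3533 / 50000)) * PF + (sᵢ - sₖ + 2 * (3533 / 50000) * pₖ) ∧
        sₖ + 3533 / 50000 * pₖ ≤ sᵢ)) :
    T - c < 2 * p := by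
  by_contra! hpc
  rcases h4 with h4 | ⟨h4, h5⟩
  · linarith
  · linarith

/-- A job that completes after `1.4817 T` is longer than half of the time that the offline
schedule has from the critical time on. -/
lemma sub_critical_lt (h : Comparison r p s q μ ν T) (hc : IsCriticalTime r p s μ ℓ c)
    (hℓ : 14817 / 10000 * T < s ℓ + p ℓ) : T - c < 2 * p ℓ := by
  classical
  have h1 := h.load_from_critical hc
  have h2 := h.offline_load_from_critical hc
  have h3 := h.total_load_critical hc
  have h4 := fun i hi => h.wait_load_before (c := c) (i := i) hi
  have hcard : (Finset.univ.filter fun j => s j < c ∧ c < s j + p j).card ≤ 2 := by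
    rw [← Set.ncard_coe_finset]
    simpa using hc.carry
  have hA : ∀ j ∈ Finset.univ.filter fun j => s j < c ∧ c < s j + p j, s j < c :=
    fun j hj => (Finset.mem_filter.1 hj).2.1
  generalize (Finset.univ.filter fun j => s j < c ∧ c < s j + p j) = A at *
  generalize ∑ j with c ≤ s j ∧ s j < s ℓ, p j = PN at *
  generalize ∑ j with s j + p j ≤ c, p j = PF at *
  have hpℓ := h.p_pos ℓ
  have hc0 := hc.nonneg
  interval_cases hn : A.card
  · rw [Finset.card_eq_zero] at hn
    subst hn
    simp only [Finset.sum_empty, zero_add] at h1 h2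
    linarith
  · obtain ⟨i, rfl⟩ := Finset.card_eq_one.1 hn
    simp only [Finset.sum_singleton] at h1 h2
    have h5 := le_max_left 0 (p i - (c - r i))
    have h6 := le_max_right 0 (p i - (c - r i))
    have h7 := hA i (by simp)
    have h8 := h.r_nonneg i
    linarith
  · obtain ⟨i, k, hik, rfl⟩ := Finset.card_eq_two.1 hn
    rw [Finset.sum_pair hik] at h1 h2 h3
    have hi := hA i (by simp)
    have hk := hA k (by simp)
    have h4i := h4 i hi
    have h4k := h4 k hk
    rw [Finset.sum_pair hik, if_neg (lt_irrefl _)] at h4i h4k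
    have h5 := le_max_left 0 (p i - (c - r i))
    have h6 := le_max_right 0 (p i - (c - r i))
    have h7 := le_max_left 0 (p k - (c - r k))
    have h8 := le_max_right 0 (p k - (c - r k))
    rcases le_total (s k - r k) (s i - r i) with h9 | h9
    · refine critical_numeric hpℓ hℓ h1 h2 h3 h6 h8 h5 h7 hi hk (h.r_nonneg k) h9 ?_
      split_ifs at h4i with hh
      · exact Or.inr ⟨by linarith, h.lock _ _ hh⟩
      · exact Or.inl (by linarith)
    · refine critical_numeric (sᵢ := s k) (pᵢ := p k) (rᵢ := r k) (sₖ := s i) (pₖ := p i)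
        (rₖ := r i) (PN := PN) (PF := PF) hpℓ hℓ (by linarith) (wᵢ := max 0 (p k - (c - r k)))
        (wₖ := max 0 (p i - (c - r i))) (by linarith) (by linarith) h8 h6 h7 h5 hk hi
        (h.r_nonneg i) h9 ?_
      split_ifs at h4k with hh
      · exact Or.inr ⟨by linarith, h.lock _ _ hh⟩
      · exact Or.inl (by linarith)

/-- A carried job leaves at most `0.54 T` more work after `c` online than offline: either it is no
longer than that, or by `wait_le_of_long` it waited no longer. Together with `T - c < 2 p ℓ` the
load bounds give `0.3651 T < 2.7066 p ℓ`. -/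
lemma lt_of_completion_gt (h : Comparison r p s q μ ν T) (hc : IsCriticalTime r p s μ ℓ c)
    (hℓ : 14817 / 10000 * T < s ℓ + p ℓ) : 337 / 2500 * T < p ℓ := by
  classical
  have hT := h.T_pos ℓ
  have h0 := h.sub_critical_lt hc hℓ
  have h1 := h.load_from_critical hc
  have h2 := h.offline_load_from_critical hc
  have hcard : (Finset.univ.filter fun j => s j < c ∧ c < s j + p j).card ≤ 2 := by
    rw [← Set.ncard_coe_finset]
    simpa using hc.carry
  have hA : ∑ j with s j < c ∧ c < s j + p j, (s j + p j - c) ≤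
      ∑ j with s j < c ∧ c < s j + p j, max 0 (p j - (c - r j)) + 2 * (27 / 50 * T) := by
    have : ∑ j with s j < c ∧ c < s j + p j, (s j + p j - c - max 0 (p j - (c - r j))) ≤
        (Finset.univ.filter fun j => s j < c ∧ c < s j + p j).card • (27 / 50 * T) := by
      refine Finset.sum_le_card_nsmul _ _ _ fun j hj => ?_
      have h5 := le_max_left 0 (p j - (c - r j))
      have h6 := le_max_right 0 (p j - (c - r j))
      have h7 := (Finset.mem_filter.1 hj).2.1
      rcases le_or_gt (p j) (27 / 50 * T) with h8 | h8
      · linarith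
      · linarith [h.wait_le_of_long h8]
    rw [Finset.sum_sub_distrib, nsmul_eq_mul] at this
    have h9 : ((Finset.univ.filter fun j => s j < c ∧ c < s j + p j).card : ℝ) ≤ 2 := by
      exact_mod_cast hcard
    nlinarith
  have hw : 0 ≤ ∑ j with s j < c ∧ c < s j + p j, max 0 (p j - (c - r j)) :=
    Finset.sum_nonneg fun j _ => le_max_left _ _
  linarith

end Comparison

/-! ### Packing contradictions with three big machines. -/

/-- Some job at least as long as `ℓ` that SLEEPY starts after the release of `ℓ` is processed
offline on machine `M`. -/
def HasBig {J : Type*} (r p s : J → ℝ) (ν : J → Fin 3) (ℓ : J) (M : Fin 3) : Prop :=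
  ∃ B, r ℓ ≤ s B ∧ p ℓ ≤ p B ∧ ν B = M

namespace Comparison

variable {J : Type*} {r p s q : J → ℝ} {μ ν : J → Fin 3} {T : ℝ} {ℓ : J} {c δ : ℝ}

lemma le_of_hasBig (h : Comparison r p s q μ ν T) {i : J} (hB : HasBig r p s ν ℓ (ν i))
    (hi : s i < r ℓ) : p i + p ℓ ≤ T := by
  obtain ⟨B, h1, h2, h3⟩ := hB
  linarith [h.pair_le (ne_of_start_lt (hi.trans_le h1)) h3.symm]

lemma pair_le_of_hasBig (h : Comparison r p s q μ ν T) {i j : J} (hB : HasBig r p s ν ℓ (ν i))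
    (hij : i ≠ j) (hν : ν i = ν j) (hi : s i < r ℓ) (hj : s j < r ℓ) :
    p i + p j + p ℓ ≤ T := by
  obtain ⟨B, h1, h2, h3⟩ := hB
  linarith [h.triple_le hij (ne_of_start_lt (hi.trans_le h1)) (ne_of_start_lt (hj.trans_le h1))
    hν h3.symm]

lemma sum_chain_le (h : Comparison r p s q μ ν T) {Q S : Finset J} (hQ : Q ⊆ S) :
    ∑ j ∈ Q, p j ≤ ∑ j ∈ S, p j :=
  Finset.sum_le_sum_of_subset_of_nonneg hQ fun j _ _ => (h.p_pos j).le

variable [Fintype J]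

/-- Three big machines, one waiting job. -/
lemma three_big_one (h : Comparison r p s q μ ν T) (hp : 337 / 2500 * T < p ℓ)
    (hbig : ∀ M, HasBig r p s ν ℓ M) {Y : J} (hY : s Y < r ℓ) (hpY : 4817 / 10000 * T < p Y)
    (hd : r Y + 4817 / 10000 * T < s Y) : False := by
  have hT := h.T_pos ℓ
  have := h.le_of_hasBig (hbig _) hY
  exact h.false_of_heavy (β := p ℓ) (by linarith) hpY hd
    (fun i hi => h.le_of_hasBig (hbig _) (hi.trans_lt hY))
    (fun i j hij hν hi hj => h.pair_le_of_hasBig (hbig _) hij hν (hi.trans_lt hY)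
      (hj.trans_lt hY)) (by linarith) (by linarith)

/-- Three big machines, two waiting jobs. -/
lemma three_big_two (h : Comparison r p s q μ ν T) (hp : 337 / 2500 * T < p ℓ)
    (hbig : ∀ M, HasBig r p s ν ℓ M) {Y Y' : J} (hY : s Y < r ℓ) (hY' : s Y' < r ℓ)
    (hYY' : s Y < s Y') (hpY : δ < p Y) (hpY' : δ < p Y') (hd : r Y + δ < s Y)
    (hδ : 4817 / 10000 * T - 2 * (3533 / 50000) * p ℓ ≤ δ) : False := by
  classical
  have hT := h.T_pos ℓ
  have hpYl := h.le_of_hasBig (hbig _) hY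
  obtain ⟨τ, Q, z, hQ, -, hτ, -, hz, hz'⟩ := h.exists_heavy (by linarith) hpY hd
  have hzs : ∀ M, s (z M) < s Y := fun M => (hz' M).1.trans_le hτ
  have hsep : ∀ i j, i ≠ j → δ < p i → δ < p j → s i < r ℓ → s j < r ℓ → ν i ≠ ν j :=
    fun i j hij hi hj hsi hsj hν => by
      linarith [h.pair_le_of_hasBig (hbig _) hij hν hsi hsj]
  have hYY := hsep Y Y' (ne_of_start_lt hYY') hpY hpY' hY hY'
  have hQY : ∀ a ∈ Q, ν a ≠ ν Y ∧ ν a ≠ ν Y' := fun a ha =>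
    ⟨hsep a Y (ne_of_start_lt (hQ a ha).2.2) (hQ a ha).1 hpY ((hQ a ha).2.2.trans hY) hY,
     hsep a Y' (ne_of_start_lt ((hQ a ha).2.2.trans hYY')) (hQ a ha).1 hpY'
      ((hQ a ha).2.2.trans hY) hY'⟩
  -- `Y` and `Y'` take two offline machines, and the third has room for one chain job only.
  have hQ1 : ∀ a ∈ Q, ∀ b ∈ Q, a = b := fun a ha b hb => by
    by_contra hab
    exact hsep a b hab (hQ a ha).1 (hQ b hb).1 ((hQ a ha).2.2.trans hY) ((hQ b hb).2.2.trans hY)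
      (fin_three_rest hYY (hQY a ha).1 (hQY a ha).2 (hQY b hb).1 (hQY b hb).2)
  have hzY : ∀ M, z M ≠ Y ∧ z M ≠ Y' := fun M =>
    ⟨ne_of_start_lt (hzs M), ne_of_start_lt ((hzs M).trans hYY')⟩
  rcases Q.eq_empty_or_nonempty with rfl | ⟨a, ha⟩
  · simp only [Finset.sum_empty, mul_zero, sub_zero] at hz'
    have h1 : ∀ M, ν (z M) ≠ ν Y ∧ ν (z M) ≠ ν Y' := fun M =>
      ⟨hsep _ _ (hzY M).1 (hz' M).2.2 hpY ((hzs M).trans hY) hY,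
       hsep _ _ (hzY M).2 (hz' M).2.2 hpY' ((hzs M).trans hY) hY'⟩
    exact hsep _ _ (hz.ne (show (0 : Fin 3) ≠ 1 by decide)) (hz' 0).2.2 (hz' 1).2.2
      ((hzs 0).trans hY) ((hzs 1).trans hY)
      (fin_three_rest hYY (h1 0).1 (h1 0).2 (h1 1).1 (h1 1).2)
  · have hQa : Q = {a} := Finset.eq_singleton_iff_unique_mem.2 ⟨ha, fun b hb => hQ1 b hb a ha⟩
    subst hQa
    rw [Finset.sum_singleton] at hz'
    have hpa := h.p_le a
    have hpa' := hQ a ha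
    have h1 : ∀ M, ν (z M) = ν Y ∨ ν (z M) = ν Y' := fun M => by
      rcases fin_three_cover hYY (hQY a ha).1.symm (hQY a ha).2.symm (ν (z M)) with h2 | h2 | h2
      · exact Or.inl h2
      · exact Or.inr h2
      · linarith [h.pair_le_of_hasBig (hbig _)
          (ne_of_start_lt ((hz' M).1.trans_le (hQ a ha).2.1)) h2 ((hzs M).trans hY)
          ((hQ a ha).2.2.trans hY), (hz' M).2.2]
    have hpY'l := h.le_of_hasBig (hbig _) hY'
    have h3 : ∀ M N, M ≠ N → ν (z M) ≠ ν (z N) := fun M N hMN hν => by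
      rcases h1 M with h4 | h4
      · linarith [h.triple_le (hz.ne hMN) (hzY M).1 (hzY N).1 hν h4, (hz' M).2.2, (hz' N).2.2]
      · linarith [h.triple_le (hz.ne hMN) (hzY M).2 (hzY N).2 hν h4, (hz' M).2.2, (hz' N).2.2]
    obtain ⟨M, N, hMN, hν⟩ := exists_ne_map_eq_of_two_values (f := fun M => ν (z M)) h1
    exact h3 M N hMN hν

/-- Three big machines, three waiting jobs. -/
lemma three_big_three (h : Comparison r p s q μ ν T)
    (hbig : ∀ M, HasBig r p s ν ℓ M) {Y : Fin 3 → J} (hinj : Function.Injective Y)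
    (hY : ∀ M, s (Y M) < r ℓ) (hfirst : ∀ M, s (Y 0) ≤ s (Y M)) (hpY : ∀ M, δ < p (Y M))
    (hd : r (Y 0) + δ < s (Y 0)) (hδ : 17 / 50 * T ≤ δ) (hp : δ < p ℓ) : False := by
  classical
  have hT := h.T_pos ℓ
  obtain ⟨τ, Q, z, hQ, -, hτ, -, hz, hz'⟩ := h.exists_heavy (by linarith) (hpY 0) hd
  have hsep : ∀ i j, i ≠ j → δ < p i → δ < p j → s i < r ℓ → s j < r ℓ → ν i ≠ ν j :=
    fun i j hij hi hj hsi hsj hν => by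
      linarith [h.pair_le_of_hasBig (hbig _) hij hν hsi hsj]
  have hYinj : Function.Injective fun M => ν (Y M) := fun M N hMN => by
    by_contra hne
    exact hsep _ _ (hinj.ne hne) (hpY M) (hpY N) (hY M) (hY N) hMN
  have hno : ∀ a, δ < p a → s (Y 0) ≤ s a := fun a ha => by
    by_contra! hlt
    obtain ⟨M, hM⟩ := Finite.injective_iff_surjective.1 hYinj (ν a)
    exact hsep _ _ (ne_of_start_lt (hlt.trans_le (hfirst M))) ha (hpY M) (hlt.trans (hY 0))
      (hY M) hM.symm
  have hQe : Q = ∅ := Finset.eq_empty_of_forall_notMem fun a ha =>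
    absurd (hno a (hQ a ha).1) (not_le.2 (hQ a ha).2.2)
  subst hQe
  simp only [Finset.sum_empty, mul_zero, sub_zero] at hz'
  exact absurd (hno _ (hz' 0).2.2) (not_le.2 ((hz' 0).1.trans_le hτ))

/-! ### Packing contradictions with two big machines. -/

/-- Two big machines with a waiting job each. -/
lemma two_big_both (h : Comparison r p s q μ ν T) {Y Y' : J} (hA : HasBig r p s ν ℓ (ν Y))
    (hB : HasBig r p s ν ℓ (ν Y')) (hYν : ν Y ≠ ν Y') (hY : s Y < r ℓ) (hY' : s Y' < r ℓ)
    (hYY' : s Y < s Y') (hpY : δ < p Y) (hpY' : δ < p Y') (hd : r Y + δ < s Y)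
    (n1 : T ≤ 2 * δ - 3533 / 50000 * T + p ℓ) (n2 : T ≤ 3 * (δ - 3533 / 50000 * T)) : False := by
  classical
  have hT := h.T_pos ℓ
  obtain ⟨τ, Q, z, hQ, -, hτ, -, hz, hz'⟩ := h.exists_heavy (by linarith) hpY hd
  have hzs : ∀ M, s (z M) < s Y := fun M => (hz' M).1.trans_le hτ
  have hno : ∀ i, δ - 3533 / 50000 * T < p i → s i < s Y → ν i ≠ ν Y ∧ ν i ≠ ν Y' := by
    intro i hi hs
    refine ⟨fun hν => ?_, fun hν => ?_⟩
    · linarith [h.pair_le_of_hasBig hA (ne_of_start_lt hs).symm hν.symm hY (hs.trans hY)]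
    · linarith [h.pair_le_of_hasBig hB (ne_of_start_lt (hs.trans hYY')).symm hν.symm hY'
        (hs.trans hY)]
  obtain ⟨F, hF1, hF2⟩ := fin_three_exists_other (ν Y) (ν Y')
  have hF : ∀ i, δ - 3533 / 50000 * T < p i → s i < s Y → ν i = F := fun i hi hs =>
    fin_three_rest hYν (hno i hi hs).1 (hno i hi hs).2 hF1 hF2
  -- The whole chain lies on one offline machine, so its locks span at most `α T`. This is why the
  -- threshold `δ - α T` also covers the jobs `z M`.
  have hsum := h.machine_load Q F (fun j hj => hF j (by linarith [(hQ j hj).1]) (hQ j hj).2.2)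
    (fun j _ => h.r_nonneg j) hT.le
  have hzF : ∀ M, ν (z M) = F := fun M => hF _ (by linarith [(hz' M).2.2]) (hzs M)
  linarith [h.triple_le (hz.ne (show (0 : Fin 3) ≠ 1 by decide))
    (hz.ne (show (0 : Fin 3) ≠ 2 by decide)) (hz.ne (show (1 : Fin 3) ≠ 2 by decide))
    ((hzF 0).trans (hzF 1).symm) ((hzF 0).trans (hzF 2).symm), (hz' 0).2.2, (hz' 1).2.2,
    (hz' 2).2.2]

end Comparison

namespace Comparison

variable {J : Type*} [Fintype J] {r p s q : J → ℝ} {μ ν : J → Fin 3} {T : ℝ} {ℓ : J} {c δ : ℝ}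

/-- While `Y` waits, a long job `v` cannot start late if there are no further long jobs than `Y`,
`x`, `v` and `y`: something has to occupy the machine before. -/
lemma two_big_late (h : Comparison r p s q μ ν T) {Y x v y : J} (hA : HasBig r p s ν ℓ (ν Y))
    (hB : HasBig r p s ν ℓ (ν x)) (hYx : ν Y ≠ ν x) (hvY : ν v ≠ ν Y) (hvx : ν v ≠ ν x)
    (hyv : ν y = ν v) (hne : v ≠ y) (hY : s Y < r ℓ) (hxs : s x < s Y) (hvs : s v < s Y)
    (hys : s y < s Y) (hpY : δ < p Y) (hpx : δ < p x) (hpv : δ < p v) (hpy : δ < p y)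
    (n0 : T ≤ 2 * δ + p ℓ) (n1 : T ≤ 3 * δ) (hgap : r Y + 3 * (3533 / 50000) * T < s v)
    (nA : T ≤ p Y + p ℓ + (s v - r Y - 3533 / 50000 * (p x + p y)))
    (nB : T ≤ p x + p ℓ + (s v - r Y - 3533 / 50000 * (p x + p y)))
    (nF : T ≤ p v + p y + (s v - r Y - 3533 / 50000 * (p x + p y))) : False := by
  classical
  obtain ⟨τ, Q, z, hQ, hτQ, hτ, hrτ, hz, hz'⟩ := h.exists_chain Y hgap hvs.le
  have hxy : x ≠ y := fun hh => hvx (by rw [hh, hyv])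
  have hlong : ∀ j, r Y ≤ s j → s j < s v → j = x ∨ j = y := by
    intro j hj hjv
    have hpj := h.longest Y j hj (hjv.trans hvs)
    have hjℓ := (hjv.trans hvs).trans hY
    by_contra! hh
    rcases fin_three_cover hYx hvY.symm hvx.symm (ν j) with h1 | h1 | h1
    · linarith [h.pair_le_of_hasBig hA (ne_of_start_lt (hjv.trans hvs)).symm h1.symm hY hjℓ]
    · linarith [h.pair_le_of_hasBig hB hh.1.symm h1.symm (hxs.trans hY) hjℓ]
    · linarith [h.triple_le hh.2 (ne_of_start_lt hjv) hne.symm (h1.trans hyv.symm) h1]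
  have hsum : ∑ j ∈ Q, p j ≤ p x + p y := by
    rw [← Finset.sum_pair hxy]
    refine h.sum_chain_le fun j hj => ?_
    rcases hlong j (by linarith [(hQ j hj).1]) (hQ j hj).2 with rfl | rfl <;> simp
  obtain ⟨M, hMx, hMy⟩ := exists_not_mem_pair hz x y
  have hM := hz' M
  have hMv : s (z M) < s v := hM.1.trans_le hτ
  have hMY := hMv.trans hvs
  -- Only `x` and `y` can start between the release of `Y` and the start of `v`. So `z M` is older
  -- and runs up to `τ`, which makes it too long for any of the three offline machines by `nA`, `nB`
  -- and `nF`.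
  have hold : s (z M) < r Y := by
    by_contra! hh
    rcases hlong _ hh hMv with h1 | h1
    · exact hMx h1
    · exact hMy h1
  rcases fin_three_cover hYx hvY.symm hvx.symm (ν (z M)) with h1 | h1 | h1
  · linarith [h.pair_le_of_hasBig hA (ne_of_start_lt hMY).symm h1.symm hY (hMY.trans hY)]
  · linarith [h.pair_le_of_hasBig hB hMx.symm h1.symm (hxs.trans hY) (hMY.trans hY)]
  · linarith [h.triple_le hMy (ne_of_start_lt hMv) hne.symm (h1.trans hyv.symm) h1]

/-- Two big machines, only one of them with a waiting job `Y`; the long job `Y'` is processed on the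
third machine offline. -/
lemma two_big_one_of_unlocked (h : Comparison r p s q μ ν T) {Y Y' : J} {b : Fin 3}
    (hp : 337 / 2500 * T < p ℓ) (hA : HasBig r p s ν ℓ (ν Y)) (hB : HasBig r p s ν ℓ b)
    (hYb : ν Y ≠ b) (hY'Y : ν Y' ≠ ν Y) (hY'b : ν Y' ≠ b) (hY : s Y < r ℓ)
    (hpY : 4817 / 10000 * T < p Y) (hrY : r Y + p Y + p ℓ ≤ T)
    (hd : r Y + 4817 / 10000 * T < s Y) (hpY' : 4817 / 10000 * T < p Y')
    (hC : 14817 / 10000 * T - p ℓ < s Y' + p Y')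
    (hload : p Y ≤ p Y' → 14451 / 10000 * T ≤ p Y + p Y' + 2 * p ℓ ∨ 6 / 25 * T < p ℓ) :
    False := by
  classical
  have hT := h.T_pos ℓ
  obtain ⟨τ, Q, z, hQ, hsτ, hτ, hrτ, hz, hz'⟩ := h.exists_heavy (by linarith) hpY hd
  have hzs : ∀ M, s (z M) < s Y := fun M => (hz' M).1.trans_le hτ
  have hzY : ∀ M, z M ≠ Y := fun M => ne_of_start_lt (hzs M)
  have hzQ : ∀ M, ∀ j ∈ Q, z M ≠ j := fun M j hj =>
    ne_of_start_lt ((hz' M).1.trans_le (hQ j hj).2.1)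
  have hcov := fin_three_cover hYb hY'Y.symm hY'b.symm
  have hA2 : ∀ i, s i < s Y → ν i = ν Y → p i + p Y + p ℓ ≤ T := fun i hi hν => by
    linarith [h.pair_le_of_hasBig hA (ne_of_start_lt hi).symm hν.symm hY (hi.trans hY)]
  have hB1 : ∀ i, s i < s Y → ν i = b → p i + p ℓ ≤ T := fun i hi hν =>
    h.le_of_hasBig (hν ▸ hB) (hi.trans hY)
  have hB2 : ∀ i j, i ≠ j → s i < s Y → s j < s Y → ν i = b → ν j = b →
      p i + p j + p ℓ ≤ T := fun i j hij hi hj hνi hνj =>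
    h.pair_le_of_hasBig (hνi ▸ hB) hij (hνi.trans hνj.symm) (hi.trans hY) (hj.trans hY)
  have hQA : ∀ a ∈ Q, ν a ≠ ν Y := fun a ha hν => by
    linarith [hA2 a (hQ a ha).2.2 hν, (hQ a ha).1]
  have hQB : ∀ a ∈ Q, ∀ a' ∈ Q, a ≠ a' → ν a = b → ν a' ≠ b := fun a ha a' ha' haa' h1 h2 => by
    linarith [hB2 a a' haa' (hQ a ha).2.2 (hQ a' ha').2.2 h1 h2, (hQ a ha).1, (hQ a' ha').1]
  have hQF : ∀ a ∈ Q, ν a ≠ b → ν a = ν Y' := fun a ha h1 => by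
    rcases hcov (ν a) with h2 | h2 | h2
    · exact absurd h2 (hQA a ha)
    · exact absurd h2 h1
    · exact h2
  have h01 : z 0 ≠ z 1 := hz.ne (by decide)
  have h02 : z 0 ≠ z 2 := hz.ne (by decide)
  have h12 : z 1 ≠ z 2 := hz.ne (by decide)
  rcases Nat.lt_or_ge 2 Q.card with hc | hc
  · have hsum : ∑ j ∈ Q, p j ≤ 2 * T - p ℓ := by
      rw [← Finset.sum_filter_add_sum_filter_not Q (fun j => ν j = b)]
      have h1 : ∑ j ∈ Q with ν j = b, p j ≤ T - p ℓ := by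
        rcases (Q.filter fun j => ν j = b).eq_empty_or_nonempty with h2 | ⟨a, ha⟩
        · rw [h2, Finset.sum_empty]
          linarith [h.p_le ℓ]
        · have ha' := Finset.mem_filter.1 ha
          have : (Q.filter fun j => ν j = b) = {a} := by
            refine Finset.eq_singleton_iff_unique_mem.2 ⟨ha, fun a' ha'' => ?_⟩
            have ha3 := Finset.mem_filter.1 ha''
            by_contra hne
            exact hQB a' ha3.1 a ha'.1 hne ha3.2 ha'.2
          rw [this, Finset.sum_singleton]
          linarith [hB1 a (hQ a ha'.1).2.2 ha'.2]
      have h2 := h.machine_load (Q.filter fun j => ¬ ν j = b) (ν Y')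
        (fun j hj => hQF j (Finset.mem_filter.1 hj).1 (Finset.mem_filter.1 hj).2)
        (fun j _ => h.r_nonneg j) hT.le
      linarith
    obtain ⟨x, hx, y, hy, w, hw, hxy, hxw, hyw, hνx, hνy, hνw⟩ : ∃ x ∈ Q, ∃ y ∈ Q, ∃ w ∈ Q,
        x ≠ y ∧ x ≠ w ∧ y ≠ w ∧ ν x = ν Y' ∧ ν y = ν Y' ∧ ν w = b := by
      obtain ⟨x, hx, y, hy, w, hw, hxy, hxw, hyw⟩ := exists_three_of_two_lt_card hc
      by_cases hxb : ν x = b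
      · exact ⟨y, hy, w, hw, x, hx, hyw, hxy.symm, hxw.symm,
          hQF y hy (hQB x hx y hy hxy hxb), hQF w hw (hQB x hx w hw hxw hxb), hxb⟩
      by_cases hyb : ν y = b
      · exact ⟨x, hx, w, hw, y, hy, hxw, hxy, hyw.symm, hQF x hx hxb,
          hQF w hw (hQB y hy w hw hyw hyb), hyb⟩
      by_cases hwb : ν w = b
      · exact ⟨x, hx, y, hy, w, hw, hxy, hxw, hyw, hQF x hx hxb, hQF y hy hyb, hwb⟩
      exfalso
      linarith [h.triple_le hxy hxw hyw ((hQF x hx hxb).trans (hQF y hy hyb).symm)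
        ((hQF x hx hxb).trans (hQF w hw hwb).symm), (hQ x hx).1, (hQ y hy).1, (hQ w hw).1]
    have hz1 : ∀ M, ν (z M) = ν Y ∨ ν (z M) = b := fun M => by
      rcases hcov (ν (z M)) with h2 | h2 | h2
      · exact Or.inl h2
      · exact Or.inr h2
      · linarith [h.triple_le hxy (hzQ M x hx).symm (hzQ M y hy).symm (hνx.trans hνy.symm)
          (hνx.trans h2.symm), (hQ x hx).1, (hQ y hy).1, (hz' M).2.2]
    have hz2 : ∀ M N, M ≠ N → ν (z M) ≠ ν (z N) := fun M N hMN hν => by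
      rcases hz1 M with h2 | h2
      · linarith [h.triple_le (hz.ne hMN) (hzY M) (hzY N) hν h2, (hz' M).2.2, (hz' N).2.2]
      · linarith [h.triple_le (hz.ne hMN) (hzQ M w hw) (hzQ N w hw) hν (h2.trans hνw.symm),
          (hz' M).2.2, (hz' N).2.2, (hQ w hw).1]
    obtain ⟨M, N, hMN, hν⟩ := exists_ne_map_eq_of_two_values (f := fun M => ν (z M)) hz1
    exact hz2 M N hMN hν
  interval_cases hcard : Q.card
  · rw [Finset.card_eq_zero] at hcard
    subst hcard
    simp only [Finset.sum_empty, mul_zero, sub_zero, add_zero] at hz' hsτ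
    have hzA : ∀ M, ν (z M) ≠ ν Y := fun M hν => by
      linarith [hA2 _ (hzs M) hν, (hz' M).2.2]
    have hzB : ∀ M N, M ≠ N → ν (z M) = b → ν (z N) ≠ b := fun M N hMN h1 h2 => by
      linarith [hB2 _ _ (hz.ne hMN) (hzs M) (hzs N) h1 h2, (hz' M).2.2, (hz' N).2.2]
    have hzF : ∀ M, ν (z M) ≠ b → ν (z M) = ν Y' := fun M h1 => by
      rcases hcov (ν (z M)) with h2 | h2 | h2
      · exact absurd h2 (hzA M)
      · exact absurd h2 h1
      · exact h2
    have key : ∀ K M N : Fin 3, K ≠ M → K ≠ N → M ≠ N → ν (z K) = b → False := by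
      intro K M N hKM hKN hMN hK
      have hM := hzF M (hzB K M hKM hK)
      have hN := hzF N (hzB K N hKN hK)
      obtain ⟨y, hys, hyY', hpy, hνy, hY's⟩ : ∃ y, s y < s Y ∧ Y' ≠ y ∧
          4817 / 10000 * T < p y ∧ ν y = ν Y' ∧ s Y' < s Y := by
        by_cases h1 : z M = Y'
        · exact ⟨z N, hzs N, h1 ▸ hz.ne hMN, (hz' N).2.2, hN, h1 ▸ hzs M⟩
        by_cases h2 : z N = Y'
        · exact ⟨z M, hzs M, h2 ▸ (hz.ne hMN).symm, (hz' M).2.2, hM, h2 ▸ hzs N⟩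
        linarith [h.triple_le (hz.ne hMN) h1 h2 (hM.trans hN.symm) hM, (hz' M).2.2, (hz' N).2.2]
      have hYy := h.pair_le hyY' hνy.symm
      have hzK := (hz' K).2.2
      have hzKp := hB1 _ (hzs K) hK
      have hYY' := h.longest Y Y' (by linarith) hY's
      -- Since `Y'` shares its offline machine with `y`, `p Y ≤ p Y' < 0.5183 T`. The first
      -- alternative then gives `2 p ℓ > (1.4451 - 1.0366) T`.
      have hpp : 51 / 250 * T < p ℓ := by
        rcases hload hYY' with h1 | h1 <;> linarith
      exact h.two_big_late hA (hK ▸ hB) (hK ▸ hYb) hY'Y (hK ▸ hY'b) hνy hyY' hY (hzs K) hY's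
        hys hpY hzK hpY' hpy (by linarith) (by linarith) (by linarith) (by linarith)
        (by linarith) (by linarith)
    by_cases h0 : ν (z 0) = b
    · exact key 0 1 2 (by decide) (by decide) (by decide) h0
    by_cases h1 : ν (z 1) = b
    · exact key 1 0 2 (by decide) (by decide) (by decide) h1
    by_cases h2 : ν (z 2) = b
    · exact key 2 0 1 (by decide) (by decide) (by decide) h2
    linarith [h.triple_le h01 h02 h12 ((hzF 0 h0).trans (hzF 1 h1).symm)
      ((hzF 0 h0).trans (hzF 2 h2).symm), (hz' 0).2.2, (hz' 1).2.2, (hz' 2).2.2]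
  · obtain ⟨a, rfl⟩ := Finset.card_eq_one.1 hcard
    simp only [Finset.mem_singleton, forall_eq, Finset.sum_singleton] at *
    have hpa := h.p_le a
    have hzA : ∀ M, ν (z M) ≠ ν Y := fun M hν => by
      linarith [hA2 _ (hzs M) hν, (hz' M).2.2]
    have h3 : ¬ (ν (z 0) = ν (z 1) ∧ ν (z 0) = ν (z 2)) := fun hh => by
      linarith [h.triple_le h01 h02 h12 hh.1 hh.2, (hz' 0).2.2, (hz' 1).2.2, (hz' 2).2.2]
    by_cases hab : ν a = b
    · have hzB : ∀ M, ν (z M) ≠ b := fun M hν => by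
        linarith [hB2 _ _ (hzQ M) (hzs M) hQ.2.2 hν hab, (hz' M).2.2]
      have h4 := fun M N => fin_three_rest hYb (hzA M) (hzB M) (hzA N) (hzB N)
      exact h3 ⟨h4 0 1, h4 0 2⟩
    · have haF := hQF hab
      have key : ∀ K M N : Fin 3, K ≠ M → K ≠ N → M ≠ N → ν (z K) = ν Y' → False := by
        intro K M N hKM hKN hMN hK
        have hoff : ∀ N, K ≠ N → ν (z N) = b := fun N hKN => by
          rcases hcov (ν (z N)) with h2 | h2 | h2
          · exact absurd h2 (hzA N)
          · exact h2
          · linarith [h.triple_le (hz.ne hKN) (hzQ K) (hzQ N) (hK.trans h2.symm)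
              (hK.trans haF.symm), (hz' K).2.2, (hz' N).2.2]
        linarith [hB2 _ _ (hz.ne hMN) (hzs M) (hzs N) (hoff M hKM) (hoff N hKN), (hz' M).2.2,
          (hz' N).2.2, h.pair_le (hzQ K) (hK.trans haF.symm), (hz' K).2.2]
      by_cases h4 : ν (z 0) = ν Y'
      · exact key 0 1 2 (by decide) (by decide) (by decide) h4
      by_cases h5 : ν (z 1) = ν Y'
      · exact key 1 0 2 (by decide) (by decide) (by decide) h5
      by_cases h6 : ν (z 2) = ν Y'
      · exact key 2 0 1 (by decide) (by decide) (by decide) h6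
      exact h3 ⟨fin_three_rest hY'Y h4 (hzA 0) h5 (hzA 1), fin_three_rest hY'Y h4 (hzA 0) h6 (hzA 2)⟩
  · obtain ⟨a, a', haa', rfl⟩ := Finset.card_eq_two.1 hcard
    have ha : a ∈ ({a, a'} : Finset J) := by simp
    have ha' : a' ∈ ({a, a'} : Finset J) := by simp
    rw [Finset.sum_pair haa'] at hz'
    have hpa := (hQ a ha).1
    have hpa' := (hQ a' ha').1
    have split : ∀ x y, x ∈ ({a, a'} : Finset J) → y ∈ ({a, a'} : Finset J) →
        p x + p y = p a + p a' → ν x = b → ν y = ν Y' → False := by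
      intro x y hx hy hxy hνx hνy
      have h1 := hB1 x (hQ x hx).2.2 hνx
      have hpy := h.p_le y
      have hpx := (hQ x hx).1
      have hpy' := (hQ y hy).1
      have hinj : Function.Injective fun M => ν (z M) := fun M N hMN => by
        by_contra hne
        obtain ⟨w, hw1, hw2, hw3, hw4⟩ : ∃ w, 4817 / 10000 * T < p w ∧ ν (z M) = ν w ∧
            z M ≠ w ∧ z N ≠ w := by
          rcases hcov (ν (z M)) with h2 | h2 | h2
          · exact ⟨Y, hpY, h2, hzY M, hzY N⟩
          · exact ⟨x, hpx, h2.trans hνx.symm, hzQ M x hx, hzQ N x hx⟩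
          · exact ⟨y, hpy', h2.trans hνy.symm, hzQ M y hy, hzQ N y hy⟩
        linarith [h.triple_le (hz.ne hne) hw3 hw4 hMN hw2, (hz' M).2.2, (hz' N).2.2]
      have hsur := Finite.injective_iff_surjective.1 hinj
      obtain ⟨M, hM⟩ := hsur (ν Y)
      obtain ⟨N, hN⟩ := hsur (ν x)
      obtain ⟨K, hK⟩ := hsur (ν y)
      linarith [hA2 _ (hzs M) hM, (hz' M).2.2,
        hB2 _ _ (hzQ N x hx) (hzs N) (hQ x hx).2.2 (Eq.trans hN hνx) hνx, (hz' N).2.2,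
        h.pair_le (hzQ K y hy) hK, (hz' K).2.2]
    by_cases hab : ν a = b
    · exact split a a' ha ha' rfl hab (hQF a' ha' (hQB a ha a' ha' haa' hab))
    by_cases ha'b : ν a' = b
    · exact split a' a ha' ha (add_comm _ _) ha'b (hQF a ha hab)
    have hνa := hQF a ha hab
    have hνa' := hQF a' ha' ha'b
    have h2 := h.pair_le haa' (hνa.trans hνa'.symm)
    have h3 : ∀ M, ν (z M) = b := fun M => by
      rcases hcov (ν (z M)) with h4 | h4 | h4
      · linarith [hA2 _ (hzs M) h4, (hz' M).2.2]
      · exact h4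
      · linarith [h.triple_le haa' (hzQ M a ha).symm (hzQ M a' ha').symm (hνa.trans hνa'.symm)
          (hνa.trans h4.symm), (hz' M).2.2]
    linarith [h.triple_le h01 h02 h12 ((h3 0).trans (h3 1).symm) ((h3 0).trans (h3 2).symm),
      (hz' 0).2.2, (hz' 1).2.2, (hz' 2).2.2]

end Comparison

namespace Comparison

variable {J : Type*} [Fintype J] {r p s q : J → ℝ} {μ ν : J → Fin 3} {T : ℝ} {ℓ : J} {c δ : ℝ}

/-- Two big machines, only one of them with a waiting job `Y`; two long jobs `U`, `V` are processed
on the third machine offline, and `V` is started after `Y`. -/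
lemma two_big_one_of_late (h : Comparison r p s q μ ν T) {Y U V : J} {b : Fin 3}
    (hp : 2249 / 10000 * T < p ℓ) (hA : HasBig r p s ν ℓ (ν Y)) (hB : HasBig r p s ν ℓ b)
    (hYb : ν Y ≠ b) (hVY : ν V ≠ ν Y) (hVb : ν V ≠ b) (hUV : ν U = ν V) (hne : U ≠ V)
    (hY : s Y < r ℓ) (hpY : δ < p Y) (hd : r Y + δ < s Y) (hpU : δ < p U) (hpV : δ < p V)
    (hδ : 411 / 1000 * T ≤ δ) (hδ' : 4817 / 10000 * T - 2 * (3533 / 50000) * p ℓ ≤ δ)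
    (hlate : s Y < s V) : False := by
  classical
  have hT := h.T_pos ℓ
  obtain ⟨τ, Q, z, hQ, -, hτ, -, hz, hz'⟩ := h.exists_heavy (by linarith) hpY hd
  have hzs : ∀ M, s (z M) < s Y := fun M => (hz' M).1.trans_le hτ
  have hzY : ∀ M, z M ≠ Y := fun M => ne_of_start_lt (hzs M)
  have hzQ : ∀ M, ∀ j ∈ Q, z M ≠ j := fun M j hj =>
    ne_of_start_lt ((hz' M).1.trans_le (hQ j hj).2.1)
  have hcov := fin_three_cover hYb hVY.symm hVb.symm
  have hpYl := h.le_of_hasBig hA hY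
  have hUVp := h.pair_le hne hUV
  have hA2 : ∀ i, s i < s Y → ν i = ν Y → p i + p Y + p ℓ ≤ T := fun i hi hν => by
    linarith [h.pair_le_of_hasBig hA (ne_of_start_lt hi).symm hν.symm hY (hi.trans hY)]
  have hB2 : ∀ i j, i ≠ j → s i < s Y → s j < s Y → ν i = b → ν j = b →
      p i + p j + p ℓ ≤ T := fun i j hij hi hj hνi hνj =>
    h.pair_le_of_hasBig (hνi ▸ hB) hij (hνi.trans hνj.symm) (hi.trans hY) (hj.trans hY)
  have hF2 : ∀ i, s i < s Y → ν i = ν V → i ≠ U → p i + p U + p V ≤ T := fun i hi hν hiU =>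
    h.triple_le hiU (ne_of_start_lt (hi.trans hlate)) hne (hν.trans hUV.symm) hν
  have hQU : ∀ a ∈ Q, ν a ≠ b → a = U := fun a ha hab => by
    by_contra haU
    rcases hcov (ν a) with h1 | h1 | h1
    · linarith [hA2 a (hQ a ha).2.2 h1, (hQ a ha).1]
    · exact hab h1
    · linarith [hF2 a (hQ a ha).2.2 h1 haU, (hQ a ha).1]
  have hsum : (∀ a ∈ Q, ν a ≠ b) → ∑ j ∈ Q, p j ≤ p U := fun hh => by
    rw [← Finset.sum_singleton p U]
    exact h.sum_chain_le fun a ha => Finset.mem_singleton.2 (hQU a ha (hh a ha))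
  have hsum' : ∑ j ∈ Q, p j ≤ 2 * T - p ℓ - δ := by
    by_cases hb : ∃ a ∈ Q, ν a = b
    · obtain ⟨a, ha, hab⟩ := hb
      have haU : a ≠ U := fun hh => hVb (by rw [← hUV, ← hh, hab])
      have h1 : ∑ j ∈ Q, p j ≤ p a + p U := by
        rw [← Finset.sum_pair haU]
        refine h.sum_chain_le fun a' ha' => ?_
        by_cases ha'b : ν a' = b
        · by_cases haa' : a' = a
          · simp [haa']
          · linarith [hB2 a' a haa' (hQ a' ha').2.2 (hQ a ha).2.2 ha'b hab, (hQ a ha).1,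
              (hQ a' ha').1]
        · simp [hQU a' ha' ha'b]
      linarith [h.le_of_hasBig (i := a) (hab ▸ hB) ((hQ a ha).2.2.trans hY)]
    · push Not at hb
      linarith [hsum hb]
  have hzU : ∀ M, z M ≠ U → ν (z M) = b := fun M hM => by
    rcases hcov (ν (z M)) with h1 | h1 | h1
    · linarith [hA2 _ (hzs M) h1, (hz' M).2.2]
    · exact h1
    · linarith [hF2 _ (hzs M) h1 hM, (hz' M).2.2]
  obtain ⟨M, N, hMN, hM, hN⟩ : ∃ M N, M ≠ N ∧ z M ≠ U ∧ z N ≠ U := by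
    obtain ⟨M, hM, -⟩ := exists_not_mem_pair hz U U
    obtain ⟨N, hN, hNM⟩ := exists_not_mem_pair hz U (z M)
    exact ⟨M, N, fun hh => hNM (by rw [hh]), hM, hN⟩
  have hMb := hzU M hM
  have hNb := hzU N hN
  have h1 := hB2 _ _ (hz.ne hMN) (hzs M) (hzs N) hMb hNb
  by_cases hb : ∃ a ∈ Q, ν a = b
  · obtain ⟨a, ha, hab⟩ := hb
    linarith [h.triple_le (hz.ne hMN) (hzQ M a ha) (hzQ N a ha) (hMb.trans hNb.symm)
      (hMb.trans hab.symm), (hz' M).2.2, (hz' N).2.2, (hQ a ha).1]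
  · push Not at hb
    rcases Q.eq_empty_or_nonempty with rfl | ⟨a, ha⟩
    · simp only [Finset.sum_empty, mul_zero, sub_zero] at hz'
      linarith [(hz' M).2.2, (hz' N).2.2]
    · have haU := hQU a ha (hb a ha)
      have h2 : ∀ M, ν (z M) = b := fun M => hzU M (haU ▸ hzQ M a ha)
      linarith [h.triple_le (hz.ne (show (0 : Fin 3) ≠ 1 by decide))
        (hz.ne (show (0 : Fin 3) ≠ 2 by decide)) (hz.ne (show (1 : Fin 3) ≠ 2 by decide))
        ((h2 0).trans (h2 1).symm) ((h2 0).trans (h2 2).symm), hsum hb, (hz' 0).2.2,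
        (hz' 1).2.2, (hz' 2).2.2]

/-- Two big machines, only one of them with a waiting job `Y`; two long jobs `U`, `V` are processed
on the third machine offline, and `ℓ` is long. -/
lemma two_big_one_of_long (h : Comparison r p s q μ ν T) {Y U V : J} {b : Fin 3}
    (hp : δ < p ℓ) (hA : HasBig r p s ν ℓ (ν Y)) (hB : HasBig r p s ν ℓ b)
    (hYb : ν Y ≠ b) (hVY : ν V ≠ ν Y) (hVb : ν V ≠ b) (hUV : ν U = ν V) (hne : U ≠ V)
    (hY : s Y < r ℓ) (hpY : δ < p Y) (hrY : r Y + p Y + p ℓ ≤ T) (hd : r Y + δ < s Y)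
    (hpU : δ < p U) (hpV : δ < p V) (hCU : T + δ - p ℓ < s U + p U)
    (hCV : T + δ - p ℓ < s V + p V) (hδ : 411 / 1000 * T ≤ δ) : False := by
  classical
  have hT := h.T_pos ℓ
  obtain ⟨τ, Q, z, hQ, -, hτ, -, hz, hz'⟩ := h.exists_heavy (by linarith) hpY hd
  have hzs : ∀ M, s (z M) < s Y := fun M => (hz' M).1.trans_le hτ
  have hzY : ∀ M, z M ≠ Y := fun M => ne_of_start_lt (hzs M)
  have hzQ : ∀ M, ∀ j ∈ Q, z M ≠ j := fun M j hj =>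
    ne_of_start_lt ((hz' M).1.trans_le (hQ j hj).2.1)
  have hcov := fin_three_cover hYb hVY.symm hVb.symm
  have hUVp := h.pair_le hne hUV
  have hA2 : ∀ i, s i < s Y → ν i = ν Y → p i + p Y + p ℓ ≤ T := fun i hi hν => by
    linarith [h.pair_le_of_hasBig hA (ne_of_start_lt hi).symm hν.symm hY (hi.trans hY)]
  have hB2 : ∀ i j, i ≠ j → s i < s Y → s j < s Y → ν i = b → ν j = b →
      p i + p j + p ℓ ≤ T := fun i j hij hi hj hνi hνj =>
    h.pair_le_of_hasBig (hνi ▸ hB) hij (hνi.trans hνj.symm) (hi.trans hY) (hj.trans hY)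
  have hF2 : ∀ i, ν i = ν V → i ≠ U → i ≠ V → p i + p U + p V ≤ T := fun i hν hiU hiV =>
    h.triple_le hiU hiV hne (hν.trans hUV.symm) hν
  have hQF : ∀ a ∈ Q, ν a ≠ b → a = U ∨ a = V := fun a ha hab => by
    by_contra! haU
    rcases hcov (ν a) with h1 | h1 | h1
    · linarith [hA2 a (hQ a ha).2.2 h1, (hQ a ha).1]
    · exact hab h1
    · linarith [hF2 a h1 haU.1 haU.2, (hQ a ha).1]
  have hsum : ∑ j ∈ Q, p j ≤ 2 * T - p ℓ := by
    by_cases hb : ∃ a ∈ Q, ν a = b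
    · obtain ⟨a, ha, hab⟩ := hb
      have haU : a ≠ U := fun hh => hVb (by rw [← hUV, ← hh, hab])
      have haV : a ≠ V := fun hh => hVb (by rw [← hh, hab])
      have h1 : ∑ j ∈ Q, p j ≤ p a + (p U + p V) := by
        rw [← Finset.sum_pair hne, ← Finset.sum_insert (by simp [haU, haV])]
        refine h.sum_chain_le fun a' ha' => ?_
        by_cases ha'b : ν a' = b
        · by_cases haa' : a' = a
          · simp [haa']
          · linarith [hB2 a' a haa' (hQ a' ha').2.2 (hQ a ha).2.2 ha'b hab, (hQ a ha).1,
              (hQ a' ha').1]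
        · rcases hQF a' ha' ha'b with h2 | h2 <;> simp [h2]
      linarith [h.le_of_hasBig (i := a) (hab ▸ hB) ((hQ a ha).2.2.trans hY)]
    · push Not at hb
      have h1 : ∑ j ∈ Q, p j ≤ p U + p V := by
        rw [← Finset.sum_pair hne]
        refine h.sum_chain_le fun a ha => ?_
        rcases hQF a ha (hb a ha) with h2 | h2 <;> simp [h2]
      linarith [h.p_le ℓ]
  have hzF : ∀ M, ν (z M) = b ∨ z M = U ∨ z M = V := fun M => by
    by_contra! hh
    rcases hcov (ν (z M)) with h1 | h1 | h1
    · linarith [hA2 _ (hzs M) h1, (hz' M).2.2]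
    · exact hh.1 h1
    · linarith [hF2 _ h1 hh.2.1 hh.2.2, (hz' M).2.2]
  obtain ⟨K, hKU, hKV⟩ := exists_not_mem_pair hz U V
  have hK : ν (z K) = b := by
    rcases hzF K with h1 | h1 | h1
    · exact h1
    · exact absurd h1 hKU
    · exact absurd h1 hKV
  have hoff : ∀ M, M ≠ K → z M = U ∨ z M = V := fun M hMK => by
    rcases hzF M with h1 | h1
    · linarith [hB2 _ _ (hz.ne hMK) (hzs M) (hzs K) h1 hK, (hz' M).2.2, (hz' K).2.2]
    · exact h1
  -- Machine `b` has room for only one of the `z M`, so the two others are `U` and `V`, which are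
  -- then not in the chain.
  obtain ⟨hUs, hVs, hUQ, hVQ⟩ : s U < s Y ∧ s V < s Y ∧ U ∉ Q ∧ V ∉ Q := by
    have : ∀ M N, M ≠ K → N ≠ K → M ≠ N → s U < s Y ∧ s V < s Y ∧ U ∉ Q ∧ V ∉ Q := by
      intro M N hM hN hMN
      rcases hoff M hM with h1 | h1 <;> rcases hoff N hN with h2 | h2
      · exact absurd (hz (h1.trans h2.symm)) hMN
      · exact ⟨h1 ▸ hzs M, h2 ▸ hzs N, fun hh => hzQ M U hh h1, fun hh => hzQ N V hh h2⟩
      · exact ⟨h2 ▸ hzs N, h1 ▸ hzs M, fun hh => hzQ N U hh h2, fun hh => hzQ M V hh h1⟩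
      · exact absurd (hz (h1.trans h2.symm)) hMN
    obtain ⟨M, hM, -⟩ := fin_three_exists_other K K
    obtain ⟨N, hN, hNM⟩ := fin_three_exists_other K M
    exact this M N hM hN hNM.symm
  have hQe : Q = ∅ := Finset.eq_empty_of_forall_notMem fun a ha => by
    by_cases hab : ν a = b
    · linarith [hB2 _ _ (hzQ K a ha) (hzs K) (hQ a ha).2.2 hK hab, (hz' K).2.2, (hQ a ha).1]
    · rcases hQF a ha hab with h1 | h1
      · exact hUQ (h1 ▸ ha)
      · exact hVQ (h1 ▸ ha)
  subst hQe
  simp only [Finset.sum_empty, mul_zero, sub_zero] at hz'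
  have hpK := (hz' K).2.2
  have hpK' := h.le_of_hasBig (i := z K) (hK ▸ hB) ((hzs K).trans hY)
  -- The later one of `U` and `V` is the job that starts too late.
  rcases le_total (s U) (s V) with h1 | h1
  · exact h.two_big_late hA (hK ▸ hB) (hK ▸ hYb) hVY (hK ▸ hVb) hUV hne.symm hY (hzs K) hVs hUs
      hpY hpK hpV hpU (by linarith) (by linarith) (by linarith) (by linarith) (by linarith)
      (by linarith)
  · exact h.two_big_late hA (hK ▸ hB) (hK ▸ hYb) (hUV ▸ hVY) (hK ▸ hUV ▸ hVb) hUV.symm hne hY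
      (hzs K) hUs hVs hpY hpK hpU hpV (by linarith) (by linarith) (by linarith) (by linarith)
      (by linarith) (by linarith)

end Comparison

/-! ### Big and old jobs, and the cases with fewer than three big machines. -/

lemma hasBig_of_card_eq_three {J : Type*} {r p s : J → ℝ} {ν : J → Fin 3} {ℓ : J} {S : Finset J}
    (hS : ∀ B ∈ S, r ℓ ≤ s B ∧ p ℓ ≤ p B) (hinj : Set.InjOn ν S) (hcard : 3 ≤ S.card)
    (M : Fin 3) : HasBig r p s ν ℓ M := by
  classical
  have h1 : S.image ν = Finset.univ := by
    apply Finset.eq_univ_of_card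
    refine le_antisymm (Finset.card_le_univ _) ?_
    rw [Finset.card_image_of_injOn hinj]
    simpa using hcard
  obtain ⟨B, hB, hM⟩ := Finset.mem_image.1 (h1 ▸ Finset.mem_univ M)
  exact ⟨B, (hS B hB).1, (hS B hB).2, hM⟩

lemma hasBig_of_ne {J : Type*} {r p s : J → ℝ} {ν : J → Fin 3} {ℓ K : J}
    (hℓ : r ℓ ≤ s ℓ) (hK : r ℓ ≤ s K) (hpK : p ℓ ≤ p K) (hne : ν ℓ ≠ ν K) :
    ∃ f, ∀ M, M ≠ f → HasBig r p s ν ℓ M := by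
  obtain ⟨f, hf1, hf2⟩ := fin_three_exists_other (ν ℓ) (ν K)
  refine ⟨f, fun M hM => ?_⟩
  rcases fin_three_cover hne hf1.symm hf2.symm M with h | h | h
  · exact ⟨ℓ, hℓ, le_rfl, h.symm⟩
  · exact ⟨K, hK, hpK, h.symm⟩
  · exact absurd h hM

namespace IsCriticalTime

variable {J : Type*} [Finite J] {r p s : J → ℝ} {μ : J → Fin 3} {ℓ : J} {c : ℝ}

lemma exists_le_start (hc : IsCriticalTime r p s μ ℓ c) {y : Fin 3 → J}
    (hy : Function.Injective y) (hC : ∀ M, c < s (y M) + p (y M)) : ∃ M, c ≤ s (y M) := by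
  by_contra! hlt
  have h1 : (Set.range y).ncard ≤ 2 := (Set.ncard_le_ncard (by
    rintro _ ⟨M, rfl⟩
    exact ⟨hlt M, hC M⟩) (Set.toFinite _)).trans hc.carry
  rw [← Set.image_univ, Set.ncard_image_of_injective _ hy] at h1
  simp at h1

end IsCriticalTime

namespace Comparison

variable {J : Type*} {r p s q : J → ℝ} {μ ν : J → Fin 3} {T : ℝ} {ℓ : J} {c δ : ℝ}

/-- Both jobs are released from `c` on, and `[c, T]` is too short for two jobs of length at least `p
ℓ`. -/
lemma ne_off_of_big (h : Comparison r p s q μ ν T) (hc : IsCriticalTime r p s μ ℓ c)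
    (hw : T - c < 2 * p ℓ) {i j : J} (hij : i ≠ j) (hi : r ℓ ≤ s i) (hj : r ℓ ≤ s j)
    (hpi : p ℓ ≤ p i) (hpj : p ℓ ≤ p j) : ν i ≠ ν j := fun hν => by
  linarith [h.pair_load hij hν (hc.release i (hc.le_release.trans hi))
    (hc.release j (hc.le_release.trans hj))]

/-- If the big job `B` were released before `Y` starts, then `p B ≤ p Y` and `Y` would be released
from `c` on, too late to share a machine with `B`. So `B` is released only after the start of `Y`;
if `B` came first offline, `Y` would end no earlier than `s Y + p Y + p ℓ > T`. Hence `Y` precedes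
`B`. -/
lemma release_add_le_of_hasBig (h : Comparison r p s q μ ν T) (hc : IsCriticalTime r p s μ ℓ c)
    (hw : T - c < 2 * p ℓ) {Y : J} (hB : HasBig r p s ν ℓ (ν Y)) (hY : s Y < r ℓ)
    (hC : T - p ℓ < s Y + p Y) : r Y + p Y + p ℓ ≤ T := by
  obtain ⟨B, hB1, hB2, hB3⟩ := hB
  have hcB := hc.release B (hc.le_release.trans hB1)
  have hYB := hY.trans_le hB1
  have hrB : s Y ≤ r B := by
    by_contra! hlt
    have h1 := h.longest B Y hlt.le hYB
    have h2 := hc.release Y (hcB.trans hlt.le)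
    linarith [h.pair_load (ne_of_start_lt hYB) hB3.symm h2 hcB]
  rcases h.disj_off Y B (ne_of_start_lt hYB) hB3.symm with h1 | h1
  · linarith [h.release_le_off Y, h.deadline B]
  · linarith [h.release_le_off B, h.deadline Y]

lemma lt_p_of_old (h : Comparison r p s q μ ν T) {Y : J} (hY : s Y < r ℓ)
    (hC : T + δ - p ℓ < s Y + p Y) : δ < p Y := by
  linarith [h.release_add_le ℓ]

/-- The lock of the earlier job `i` forces `(1 - α) p i > 0.4817 T`, so `p i > 0.5183 T`, while the
later one is longer than `0.4817 T`. -/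
lemma ne_off_of_old (h : Comparison r p s q μ ν T) {i j : J} (hij : i ≠ j)
    (hi : s i < r ℓ) (hj : s j < r ℓ) (hCi : T + 4817 / 10000 * T - p ℓ < s i + p i)
    (hCj : T + 4817 / 10000 * T - p ℓ < s j + p j) : ν i ≠ ν j := by
  intro hν
  have hT := h.T_pos ℓ
  have h1 := h.pair_le hij hν
  have h2 := h.release_add_le ℓ
  rcases lt_trichotomy (s i) (s j) with hs | hs | hs
  · linarith [h.lock i j hs]
  · exact hij (h.start_inj i j hs)
  · linarith [h.lock j i hs]

variable [Fintype J]

/-- Two jobs running across `c` and until the start of `ℓ` leave one machine, which all other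
jobs share. -/
lemma length_le_of_two_carried (h : Comparison r p s q μ ν T)
    (hc : IsCriticalTime r p s μ ℓ c) {i j : J} (hij : i ≠ j) (hi : s i < c) (hj : s j < c)
    (hCi : s ℓ ≤ s i + p i) (hCj : s ℓ ≤ s j + p j) (hcℓ : c < s ℓ) :
    s ℓ - c + p ℓ ≤ 3 * (T - c) := by
  classical
  have hμ : μ i ≠ μ j := fun hh => by
    rcases h.disj i j hij hh with h1 | h1 <;> linarith
  obtain ⟨M, hM1, hM2⟩ := fin_three_exists_other (μ i) (μ j)
  have h1 := length_le_sum_overlap (Finset.univ.filter fun k => c ≤ s k ∧ s k < s ℓ) s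
    (fun k => s k + p k) (x := c) (y := s ℓ) (by
    intro t ht ht'
    rcases hc.nonIdle t ht ht' M with ⟨k, hk, h2, h3⟩ | ⟨k, h2, h3⟩
    · refine ⟨k, Finset.mem_filter.2 ⟨Finset.mem_univ _, ?_, h2.trans_lt ht'⟩, h2, h3⟩
      by_contra! hlt
      have h4 : ({i, j, k} : Finset J).card ≤ 2 := by
        rw [← Set.ncard_coe_finset]
        refine (Set.ncard_le_ncard ?_ (Set.toFinite _)).trans hc.carry
        intro a ha
        simp only [Finset.coe_insert, Finset.coe_singleton, Set.mem_insert_iff,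
          Set.mem_singleton_iff] at ha
        rcases ha with rfl | rfl | rfl
        · exact ⟨hi, hcℓ.trans_le hCi⟩
        · exact ⟨hj, hcℓ.trans_le hCj⟩
        · exact ⟨hlt, ht.trans_lt h3⟩
      rw [Finset.card_eq_three.2 ⟨i, j, k, hij, fun hh => hM1 (by rw [hh, hk]),
        fun hh => hM2 (by rw [hh, hk]), rfl⟩] at h4
      omega
    · have hp := h.p_pos k
      refine ⟨k, Finset.mem_filter.2 ⟨Finset.mem_univ _, ?_, h2.trans_lt ht'⟩, h2, by linarith⟩
      by_contra! hlt
      linarith [hc.lock k hlt])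
  have h2 : ∑ k ∈ Finset.univ.filter (fun k => c ≤ s k ∧ s k < s ℓ),
      overlap c (s ℓ) (s k) (s k + p k) ≤
      ∑ k ∈ Finset.univ.filter (fun k => c ≤ s k ∧ s k < s ℓ), p k :=
    Finset.sum_le_sum fun k _ =>
      (overlap_le_length (by linarith [h.p_pos k])).trans (by linarith)
  have h3 := h.offline_load_from_critical hc
  have h4 : 0 ≤ ∑ k ∈ Finset.univ.filter (fun k => s k < c ∧ c < s k + p k),
      max 0 (p k - (c - r k)) := Finset.sum_nonneg fun k _ => le_max_left _ _
  linarith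

/-- Two old jobs, of which the first shares its offline machine with a big job. -/
lemma false_of_one_new_aux (h : Comparison r p s q μ ν T) (hc : IsCriticalTime r p s μ ℓ c)
    (hw : T - c < 2 * p ℓ) (hp : 337 / 2500 * T < p ℓ) (hℓ : 14817 / 10000 * T < s ℓ + p ℓ)
    {f : Fin 3} (hbig : ∀ M, M ≠ f → HasBig r p s ν ℓ M) {Y Y' : J} (hne : Y ≠ Y')
    (hY : s Y < r ℓ) (hY' : s Y' < r ℓ) (hCY : s ℓ ≤ s Y + p Y) (hCY' : s ℓ ≤ s Y' + p Y')
    (hf : ν Y ≠ f) (hf' : ν Y' = f) : False := by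
  have hT := h.T_pos ℓ
  have hpY := h.lt_p_of_old (δ := 4817 / 10000 * T) hY (by linarith)
  have hpY' := h.lt_p_of_old (δ := 4817 / 10000 * T) hY' (by linarith)
  have hrY := h.release_add_le_of_hasBig hc hw (hbig _ hf) hY (by linarith)
  obtain ⟨b, hb1, hb2⟩ := fin_three_exists_other (ν Y) f
  refine h.two_big_one_of_unlocked hp (hbig _ hf) (hbig b hb2) hb1.symm (by rw [hf']; exact hf.symm)
    (by rw [hf']; exact hb2.symm) hY hpY hrY (by linarith) hpY' (by linarith) fun _ => ?_
  -- If both jobs run across `c`, all other jobs share one machine, which gives `s ℓ + p ℓ + 2 c ≤ 3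
  -- T` and the constant `3 · 1.4817 - 3 = 1.4451`. Otherwise one of them is released from `c` on,
  -- so `0.4817 T < T - c < 2 p ℓ`.
  rcases lt_or_ge (s Y) c with h1 | h1
  · rcases lt_or_ge (s Y') c with h2 | h2
    · left
      have := h.length_le_of_two_carried hc hne h1 h2 hCY hCY'
        (by linarith [hc.le_release, h.release_add_le ℓ])
      linarith
    · right
      linarith [hc.release Y' h2, h.release_add_le Y']
  · right
    linarith [hc.release Y h1, h.release_add_le Y]

lemma false_of_one_new (h : Comparison r p s q μ ν T) (hc : IsCriticalTime r p s μ ℓ c)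
    (hw : T - c < 2 * p ℓ) (hp : 337 / 2500 * T < p ℓ) (hℓ : 14817 / 10000 * T < s ℓ + p ℓ)
    {f : Fin 3} (hbig : ∀ M, M ≠ f → HasBig r p s ν ℓ M) {Y Y' : J} (hlt : s Y < s Y')
    (hY : s Y < r ℓ) (hY' : s Y' < r ℓ) (hCY : s ℓ ≤ s Y + p Y) (hCY' : s ℓ ≤ s Y' + p Y') :
    False := by
  have hT := h.T_pos ℓ
  have hpY := h.lt_p_of_old (δ := 4817 / 10000 * T) hY (by linarith)
  have hpY' := h.lt_p_of_old (δ := 4817 / 10000 * T) hY' (by linarith)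
  have hne := ne_of_start_lt hlt
  have hν := h.ne_off_of_old hne hY hY' (by linarith) (by linarith)
  by_cases hf : ν Y = f
  · exact h.false_of_one_new_aux hc hw hp hℓ hbig hne.symm hY' hY hCY' hCY
      (fun hh => hν (hf.trans hh.symm)) hf
  by_cases hf' : ν Y' = f
  · exact h.false_of_one_new_aux hc hw hp hℓ hbig hne hY hY' hCY hCY' hf hf'
  have hrY := h.release_add_le_of_hasBig hc hw (hbig _ hf) hY (by linarith)
  exact h.two_big_both (hbig _ hf) (hbig _ hf') hν hY hY' hlt hpY hpY' (by linarith)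
    (by linarith) (by linarith)

/-- The case of one chain job and three old jobs. At most one old job lies on a big machine by
`two_big_both`, and not all three fit on `f`; so one lies on a big machine and waited for long, and
the two others share `f`. -/
lemma false_of_one_locker (h : Comparison r p s q μ ν T) (hc : IsCriticalTime r p s μ ℓ c)
    (hw : T - c < 2 * p ℓ) {f : Fin 3} (hbig : ∀ M, M ≠ f → HasBig r p s ν ℓ M)
    {y : Fin 3 → J} (hy : Function.Injective y) (hold : ∀ M, s (y M) < r ℓ)
    (hC : ∀ M, T + δ - p ℓ < s (y M) + p (y M))
    (hδ : 4817 / 10000 * T - 3533 / 50000 * (T - c) ≤ δ) : False := by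
  have hT := h.T_pos ℓ
  have hcℓ : c ≤ T - p ℓ := by linarith [hc.le_release, h.release_add_le ℓ]
  have hpy : ∀ M, δ < p (y M) := fun M => h.lt_p_of_old (hold M) (hC M)
  have hc0 := hc.nonneg
  obtain ⟨Z, hZ⟩ := hc.exists_le_start hy fun M => by linarith [hC M]
  have hcZ : c + δ < T := by linarith [hc.release _ hZ, h.release_add_le (y Z), hpy Z]
  have hwδ : T ≤ 2 * δ + p ℓ := by linarith
  have hr : ∀ M, ν (y M) ≠ f → r (y M) + p (y M) + p ℓ ≤ T := fun M hM =>
    h.release_add_le_of_hasBig hc hw (hbig _ hM) (hold M) (by linarith [hC M])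
  have hsep : ∀ M N, M ≠ N → ν (y M) ≠ f → ν (y M) ≠ ν (y N) := fun M N hMN hM hν => by
    linarith [h.pair_le_of_hasBig (hbig _ hM) (hy.ne hMN) hν (hold M) (hold N), hpy M, hpy N]
  have hboth : ∀ M N, M ≠ N → ν (y M) ≠ f → ν (y N) = f := by
    intro M N hMN hM
    by_contra hN
    rcases lt_trichotomy (s (y M)) (s (y N)) with hs | hs | hs
    · exact h.two_big_both (hbig _ hM) (hbig _ hN) (hsep M N hMN hM) (hold M) (hold N) hs (hpy M)
        (hpy N) (by linarith [hr M hM, hC M]) (by linarith) (by linarith)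
    · exact hMN (hy (h.start_inj _ _ hs))
    · exact h.two_big_both (hbig _ hN) (hbig _ hM) (hsep M N hMN hM).symm (hold N) (hold M) hs
        (hpy N) (hpy M) (by linarith [hr N hN, hC N]) (by linarith) (by linarith)
  obtain ⟨A, hA⟩ : ∃ A, ν (y A) ≠ f := by
    by_contra! hh
    linarith [h.triple_le (hy.ne (show (0 : Fin 3) ≠ 1 by decide))
      (hy.ne (show (0 : Fin 3) ≠ 2 by decide)) (hy.ne (show (1 : Fin 3) ≠ 2 by decide))
      ((hh 0).trans (hh 1).symm) ((hh 0).trans (hh 2).symm), hpy 0, hpy 1, hpy 2]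
  have hdA : r (y A) + δ < s (y A) := by linarith [hr A hA, hC A]
  have hδT : 411 / 1000 * T ≤ δ := by linarith
  obtain ⟨b, hb1, hb2⟩ := fin_three_exists_other (ν (y A)) f
  by_cases hpδ : δ < p ℓ
  · obtain ⟨U, hU, -⟩ := fin_three_exists_other A A
    obtain ⟨V, hV, hVU⟩ := fin_three_exists_other A U
    have hU' := hboth A U hU.symm hA
    have hV' := hboth A V hV.symm hA
    exact h.two_big_one_of_long hpδ (hbig _ hA) (hbig b hb2) hb1.symm
      (by rw [hV']; exact hA.symm) (by rw [hV']; exact hb2.symm) (hU'.trans hV'.symm)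
      (hy.ne hVU.symm) (hold A) (hpy A) (hr A hA) hdA (hpy U) (hpy V) (hC U) (hC V) hδT
  -- Otherwise `p (y A) + p ℓ ≤ T - c < 2 p ℓ`, whence `δ < p (y A) < p ℓ`.
  · have hsA : s (y A) < c := by
      by_contra! hcA
      linarith [hc.release _ hcA, hr A hA, hpy A]
    have hAZ : A ≠ Z := by
      rintro rfl
      linarith
    obtain ⟨U, hU, hUZ⟩ := fin_three_exists_other A Z
    have hU' := hboth A U hU.symm hA
    have hZ' := hboth A Z hAZ hA
    -- As `y Z` is released from `c` on, `δ < T - c`; so `1.07066 (T - c) > 0.4817 T`, which gives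
    -- `p ℓ > 0.2249 T`.
    exact h.two_big_one_of_late (by linarith) (hbig _ hA) (hbig b hb2) hb1.symm
      (by rw [hZ']; exact hA.symm) (by rw [hZ']; exact hb2.symm) (hU'.trans hZ'.symm)
      (hy.ne hUZ) (hold A) (hpy A) hdA (hpy U) (hpy Z) hδT (by linarith) (by linarith)

/-- The work that is done in two windows without idle machines. -/
lemma load_of_two_windows (h : Comparison r p s q μ ν T) {x y x' y' : ℝ}
    (hn : ∀ t, x ≤ t → t < y → NonIdle p s μ t) (hn' : ∀ t, x' ≤ t → t < y' → NonIdle p s μ t)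
    (hyx : y ≤ x') (hyℓ : y ≤ s ℓ) (hyℓ' : y' ≤ s ℓ) :
    3 * (y - x) + 3 * (y' - x') ≤ (1 + 2 * (3533 / 50000)) * (3 * T - p ℓ) := by
  classical
  have h1 := h.load hn
  have h2 := h.load hn'
  have h3 := h.sum_p_le (h.T_pos ℓ).le
  have h4 : ∀ j, (overlap x y (s j) (s j + p j) +
      2 * overlap x y (s j) (s j + 3533 / 50000 * p j)) + (overlap x' y' (s j) (s j + p j) +
      2 * overlap x' y' (s j) (s j + 3533 / 50000 * p j)) ≤
      (1 + 2 * (3533 / 50000)) * (p j - if j = ℓ then p ℓ else 0) := by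
    intro j
    have hp := h.p_pos j
    split_ifs with hj
    · subst hj
      rw [overlap_eq_zero_of_ge hyℓ, overlap_eq_zero_of_ge hyℓ, overlap_eq_zero_of_ge hyℓ',
        overlap_eq_zero_of_ge hyℓ']
      simp
    · have h5 := overlap_add_overlap_le (x := x) (y' := y')
        (show s j ≤ s j + p j by linarith) hyx
      have h6 := overlap_add_overlap_le (x := x) (y' := y')
        (show s j ≤ s j + 3533 / 50000 * p j by linarith) hyx
      linarith
  have h5 := Finset.sum_le_sum fun j (_ : j ∈ Finset.univ) => h4 j
  rw [Finset.sum_add_distrib, ← Finset.mul_sum, Finset.sum_sub_distrib, Finset.sum_ite_eq'] at h5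
  simp only [Finset.mem_univ, if_true] at h5
  linarith

/-- Three old jobs on different offline machines: one of them shares its machine with `ℓ` and waited
for more than `0.4817 T`. Its waiting time and the time from `c` to the start of `ℓ` are both
without idle machines, which is more work than all jobs but `ℓ` provide. -/
lemma false_of_none_new (h : Comparison r p s q μ ν T) (hc : IsCriticalTime r p s μ ℓ c)
    (hw : T - c < 2 * p ℓ) (hℓ : 14817 / 10000 * T < s ℓ + p ℓ)
    {y : Fin 3 → J} (hy : Function.Injective y) (hold : ∀ M, s (y M) < r ℓ)
    (hC : ∀ M, s ℓ ≤ s (y M) + p (y M)) : False := by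
  have hT := h.T_pos ℓ
  have hrℓ := h.release_add_le ℓ
  have hcr := hc.le_release
  have hpy : ∀ M, 4817 / 10000 * T < p (y M) := fun M =>
    h.lt_p_of_old (hold M) (by linarith [hC M])
  obtain ⟨Z, hZ⟩ := hc.exists_le_start hy fun M => by linarith [hC M]
  have hcZ : c + 4817 / 10000 * T < T := by
    linarith [hc.release _ hZ, h.release_add_le (y Z), hpy Z]
  have hinj : Function.Injective fun M => ν (y M) := fun M N hMN => by
    by_contra hne
    exact h.ne_off_of_old (hy.ne hne) (hold M) (hold N) (by linarith [hC M]) (by linarith [hC N])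
      hMN
  obtain ⟨A, hA⟩ := Finite.surjective_of_injective hinj (ν ℓ)
  have hA : HasBig r p s ν ℓ (ν (y A)) := ⟨ℓ, h.release_le ℓ, le_rfl, hA.symm⟩
  have hrA := h.release_add_le_of_hasBig hc hw hA (hold A) (by linarith [hC A])
  have hpA := hpy A
  have hCA := hC A
  rcases lt_or_ge (s (y A)) c with h1 | h1
  · have := h.load_of_two_windows (ℓ := ℓ) (x := r (y A)) (y := s (y A)) (x' := c) (y' := s ℓ)
      (h.nonIdle (y A)) hc.nonIdle h1.le (by linarith) le_rfl
    linarith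
  · have h2 := hc.release _ h1
    have := h.load_of_two_windows (ℓ := ℓ) (x := r (y A)) (y := s ℓ) (x' := s ℓ) (y' := s ℓ)
      (fun t ht => hc.nonIdle t (h2.trans ht)) (fun t ht ht' => by linarith) le_rfl le_rfl le_rfl
    linarith

end Comparison

/-! ### The case distinction and the theorem. -/

namespace Comparison

variable {J : Type*} [Fintype J] {r p s q : J → ℝ} {μ ν : J → Fin 3} {T : ℝ}

lemma completion_le (h : Comparison r p s q μ ν T) (ℓ : J) : s ℓ + p ℓ ≤ 14817 / 10000 * T := by
  classical
  by_contra! hℓ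
  obtain ⟨c, hc⟩ := h.exists_isCriticalTime ℓ
  have hT := h.T_pos ℓ
  have hw := h.sub_critical_lt hc hℓ
  have hp := h.lt_of_completion_gt hc hℓ
  have hrℓ := h.release_add_le ℓ
  have hcr := hc.le_release
  have hc0 := hc.nonneg
  obtain ⟨τ, Q, y, hQ, hτQ, hτ, hrτ, hy, hyτ⟩ := h.exists_chain ℓ (by linarith) le_rfl
  set N : Finset (Fin 3) := Finset.univ.filter fun M => r ℓ ≤ s (y M) with hN
  have hnew : ∀ M ∈ N, r ℓ ≤ s (y M) := fun M hM => (Finset.mem_filter.1 hM).2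
  have hold : ∀ M, M ∉ N → s (y M) < r ℓ := fun M hM => by
    by_contra! hlt
    exact hM (Finset.mem_filter.2 ⟨Finset.mem_univ _, hlt⟩)
  set S : Finset J := insert ℓ (Q ∪ N.image y) with hS
  have hlong : ∀ B, r ℓ ≤ s B → s B < s ℓ → r ℓ ≤ s B ∧ p ℓ ≤ p B := fun B h1 h2 =>
    ⟨h1, h.longest ℓ B h1 h2⟩
  have hbigQ : ∀ B ∈ Q, r ℓ ≤ s B ∧ p ℓ ≤ p B := fun B hB =>
    hlong B (by linarith [(hQ B hB).1]) (hQ B hB).2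
  have hbigN : ∀ M ∈ N, r ℓ ≤ s (y M) ∧ p ℓ ≤ p (y M) := fun M hM =>
    hlong _ (hnew M hM) ((hyτ M).1.trans_le hτ)
  have hbigS : ∀ B ∈ S, r ℓ ≤ s B ∧ p ℓ ≤ p B := by
    intro B hB
    rcases Finset.mem_insert.1 hB with rfl | hB
    · exact ⟨h.release_le _, le_rfl⟩
    rcases Finset.mem_union.1 hB with hB | hB
    · exact hbigQ B hB
    · obtain ⟨M, hM, rfl⟩ := Finset.mem_image.1 hB
      exact hbigN M hM
  have hinj : Set.InjOn ν S := fun i hi j hj hν => by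
    by_contra hij
    exact h.ne_off_of_big hc hw hij (hbigS i hi).1 (hbigS j hj).1 (hbigS i hi).2 (hbigS j hj).2 hν
  have hcard : S.card = 1 + Q.card + N.card := by
    rw [hS, Finset.card_insert_of_notMem, Finset.card_union_of_disjoint,
      Finset.card_image_of_injective _ hy]
    · ring
    · refine Finset.disjoint_left.2 fun j hj hj' => ?_
      obtain ⟨M, -, rfl⟩ := Finset.mem_image.1 hj'
      linarith [(hQ _ hj).1, (hyτ M).1]
    · intro hh
      rcases Finset.mem_union.1 hh with hh | hh
      · exact lt_irrefl _ (hQ _ hh).2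
      · obtain ⟨M, -, hM⟩ := Finset.mem_image.1 hh
        have := (hyτ M).1
        rw [hM] at this
        linarith
  have hcard3 : S.card ≤ 3 := by
    rw [← Finset.card_image_of_injOn hinj]
    simpa using Finset.card_le_univ (S.image ν)
  have hQT : ∀ B ∈ Q, p B ≤ T - c := fun B hB => by
    linarith [hc.release B (hcr.trans (hbigQ B hB).1), h.release_add_le B]
  have hC : ∀ M, s ℓ ≤ s (y M) + p (y M) + 3533 / 50000 * ∑ j ∈ Q, p j := fun M => by
    linarith [(hyτ M).2]
  have hNall : N.card = 0 → ∀ M, s (y M) < r ℓ := fun h0 M =>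
    hold M (by rw [Finset.card_eq_zero.1 h0]; exact Finset.notMem_empty _)
  have hbigT : 3 ≤ S.card → ∀ M, HasBig r p s ν ℓ M := hasBig_of_card_eq_three hbigS hinj
  -- The big jobs, `ℓ` included, number `1 + Q.card + N.card ≤ 3`.
  have hcases : (Q.card = 0 ∧ N.card = 0) ∨ (Q.card = 0 ∧ N.card = 1) ∨
      (Q.card = 1 ∧ N.card = 0) ∨ (Q.card = 0 ∧ N.card = 2) ∨ (Q.card = 1 ∧ N.card = 1) ∨
      (Q.card = 2 ∧ N.card = 0) := by omega
  rcases hcases with ⟨hk, hn⟩ | ⟨hk, hn⟩ | ⟨hk, hn⟩ | ⟨hk, hn⟩ | ⟨hk, hn⟩ | ⟨hk, hn⟩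
  · rw [Finset.card_eq_zero.1 hk, Finset.sum_empty, mul_zero] at hC
    exact h.false_of_none_new hc hw hℓ hy (hNall hn) fun M => by linarith [hC M]
  · rw [Finset.card_eq_zero.1 hk, Finset.sum_empty, mul_zero] at hC
    obtain ⟨K, hK⟩ := Finset.card_eq_one.1 hn
    have hKN : K ∈ N := by rw [hK]; exact Finset.mem_singleton_self K
    have hKb := hbigN K hKN
    obtain ⟨f, hf⟩ := hasBig_of_ne (h.release_le ℓ) hKb.1 hKb.2
      (h.ne_off_of_big hc hw (ne_of_start_lt ((hyτ K).1.trans_le hτ)).symm (h.release_le ℓ) hKb.1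
        le_rfl hKb.2)
    obtain ⟨A, hA, -⟩ := fin_three_exists_other K K
    obtain ⟨B, hB, hBA⟩ := fin_three_exists_other K A
    have hoA := hold A (by rw [hK, Finset.mem_singleton]; exact hA)
    have hoB := hold B (by rw [hK, Finset.mem_singleton]; exact hB)
    rcases lt_trichotomy (s (y A)) (s (y B)) with hs | hs | hs
    · exact h.false_of_one_new hc hw hp hℓ hf hs hoA hoB (by linarith [hC A]) (by linarith [hC B])
    · exact hBA (hy (h.start_inj _ _ hs)).symm
    · exact h.false_of_one_new hc hw hp hℓ hf hs hoB hoA (by linarith [hC B]) (by linarith [hC A])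
  · obtain ⟨K, hK⟩ := Finset.card_eq_one.1 hk
    rw [hK, Finset.sum_singleton] at hC
    have hKQ : K ∈ Q := by rw [hK]; exact Finset.mem_singleton_self K
    have hKb := hbigQ K hKQ
    obtain ⟨f, hf⟩ := hasBig_of_ne (h.release_le ℓ) hKb.1 hKb.2
      (h.ne_off_of_big hc hw (ne_of_start_lt (hQ K hKQ).2).symm (h.release_le ℓ) hKb.1
        le_rfl hKb.2)
    exact h.false_of_one_locker (δ := 4817 / 10000 * T - 3533 / 50000 * p K) hc hw hf hy (hNall hn)
      (fun M => by linarith [hC M]) (by linarith [hQT K hKQ])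
  · rw [Finset.card_eq_zero.1 hk, Finset.sum_empty, mul_zero] at hC
    have hb := hbigT (by omega)
    obtain ⟨A, hA⟩ : ∃ A, A ∉ N := by
      by_contra! hh
      rw [Finset.eq_univ_iff_forall.2 hh] at hn
      simp at hn
    have hpA := h.lt_p_of_old (δ := 4817 / 10000 * T) (hold A hA) (by linarith [hC A])
    have hrA := h.release_add_le_of_hasBig hc hw (hb _) (hold A hA) (by linarith [hC A])
    exact h.three_big_one hp hb (hold A hA) hpA (by linarith [hC A])
  · have hb := hbigT (by omega)
    obtain ⟨K, hK⟩ := Finset.card_eq_one.1 hk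
    rw [hK, Finset.sum_singleton] at hC
    have hKT := hQT K (by rw [hK]; exact Finset.mem_singleton_self K)
    obtain ⟨L, hL⟩ := Finset.card_eq_one.1 hn
    obtain ⟨A, hA, -⟩ := fin_three_exists_other L L
    obtain ⟨B, hB, hBA⟩ := fin_three_exists_other L A
    have hoA := hold A (by rw [hL, Finset.mem_singleton]; exact hA)
    have hoB := hold B (by rw [hL, Finset.mem_singleton]; exact hB)
    have hpA := h.lt_p_of_old (δ := 4817 / 10000 * T - 3533 / 50000 * p K) hoA (by linarith [hC A])
    have hpB := h.lt_p_of_old (δ := 4817 / 10000 * T - 3533 / 50000 * p K) hoB (by linarith [hC B])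
    have hrA := h.release_add_le_of_hasBig hc hw (hb _) hoA (by linarith [hC A])
    have hrB := h.release_add_le_of_hasBig hc hw (hb _) hoB (by linarith [hC B])
    rcases lt_trichotomy (s (y A)) (s (y B)) with hs | hs | hs
    · exact h.three_big_two hp hb hoA hoB hs hpA hpB (by linarith [hC A]) (by linarith)
    · exact hBA (hy (h.start_inj _ _ hs)).symm
    · exact h.three_big_two hp hb hoB hoA hs hpB hpA (by linarith [hC B]) (by linarith)
  · have hb := hbigT (by omega)
    have ho := hNall hn
    obtain ⟨K, L, hKL, hK⟩ := Finset.card_eq_two.1 hk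
    rw [hK, Finset.sum_pair hKL] at hC
    have hKT := hQT K (by simp [hK])
    have hLT := hQT L (by simp [hK])
    set δ := 4817 / 10000 * T - 3533 / 50000 * (p K + p L) with hδ
    have hpy : ∀ M, δ < p (y M) := fun M => h.lt_p_of_old (ho M) (by linarith [hC M])
    have hr : ∀ M, r (y M) + p (y M) + p ℓ ≤ T := fun M =>
      h.release_add_le_of_hasBig hc hw (hb _) (ho M) (by linarith [hC M])
    -- At most two of the three old jobs run across `c`, so one is released from `c` on. Then `p (y
    -- Z) + p ℓ ≤ T - c < 2 p ℓ` gives `δ < p ℓ`. The bound `0.34 T ≤ δ` holds since `K` and `L`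
    -- have length at most `T`.
    obtain ⟨Z, hZ⟩ := hc.exists_le_start hy fun M => by linarith [hC M]
    have hcZ := hc.release _ hZ
    obtain ⟨A, hA⟩ := Finite.exists_min fun M => s (y M)
    -- The swap moves the earliest old job to index `0`.
    refine h.three_big_three hb (Y := fun M => y (Equiv.swap 0 A M)) (δ := δ)
      (hy.comp (Equiv.injective _)) (fun M => ho _) (fun M => ?_) (fun M => hpy _) ?_ (by linarith)
      (by linarith [hr Z, hpy Z])
    · rw [Equiv.swap_apply_left]
      exact hA _
    · rw [Equiv.swap_apply_left]
      linarith [hC A, hr A]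

end Comparison

theorem theorem2 {J : Type*} [Fintype J] (I : JobSet J) :
    (∃ S : Schedule 3 J, I.IsGeneralizedSleepy 1 0.07066 S) ∧
      ∀ S : Schedule 3 J, I.IsGeneralizedSleepy 1 0.07066 S →
        I.makespan S ≤ (1 + 0.4817) * I.opt 3 := by
  refine ⟨I.exists_isGeneralizedSleepy (by norm_num), fun S hS =>
    JobSet.makespan_le_mul_opt (by norm_num) hS.feasible fun O T hO hT j => ?_⟩
  have := (hS.comparison hO hT).completion_le j
  norm_num
  exact this
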